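/- Let $d\ge 1$, let $M$ be a real $d\times d$ matrix all of whose (complex) eigenvalues have modulus greater than $1$, let $M^*$ be its transpose and $m=|\det M|$. For a function $\phi$ on $\mathbb R^d$ put $\phi_{jk}(x)=m^{j/2}\phi(M^jx+k)$, $j\in\mathbb Z$, $k\in\mathbb Z^d$. Let $N\ge 0$ be an integer and $Lf=\sum_{[\beta]\le N}a_\beta D^\beta f$, where the sum is over multi-indices $\beta$ with $[\beta]=\beta_1+\dots+\beta_d\le N$, $a_\beta\in\mathbb C$ and $a_{\bf 0}\ne0$. Fourier transforms are taken in the sense of tempered distributions, normalized so that $\widehat f(\xi)=\int_{\mathbb R^d}f(x)e^{-2\pi i(x,\xi)}dx$ for $f\in L_1(\mathbb R^d)$. Assume: (a) $\widetilde\phi=\sum_{[\beta]\le N}\overline{a_\beta}(-1)^{[\beta]}D^\beta\delta_{\bf 0}$ is the tempered distribution associated with $L$, where $\delta_{\bf 0}$ is the Dirac delta at the origin; (b) $\phi(x)=\int_{\mathbb R^d}\theta(\xi)e^{2\pi i(x,\xi)}d\xi$, where $\theta$ vanishes outside a parallelepiped $S=[a_1,b_1]\times\dots\times[a_d,b_d]$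 with $a_i<b_i$, and $\theta|_S\in C^d(S)$; (c) $\widetilde\phi$ and $\phi$ are strictly compatible, with a number $\delta\in(0,1/2)$: $\overline{\widehat\phi(\xi)}\,\widehat{\widetilde\phi}(\xi)=1$ for a.e. $\xi$ with $|\xi|<\delta$, and $\widehat\phi(\xi)=0$ for a.e. $\xi$ with $|\xi-l|<\delta$, for every $l\in\mathbb Z^d\setminus\{\bf 0\}$. Let $j\in\mathbb Z$ and let $f:\mathbb R^d\to\mathbb C$ be a continuous function that defines a tempered distribution and whose Fourier transform $\widehat f$ is a function. If $\widehat f$ vanishes a.e. outside $\{\xi:\ |M^{*-j}\xi|<\delta\}$, then $f$ is $N$ times continuously differentiable and $$f(x)=m^{-j/2}\sum_{k\in\mathbb Z^d}L\big(f(M^{-j}\cdot)\big)(-k)\,\phi_{jk}(x)\qquad\text{for every }x\in\mathbb R^d,\tag{1}$$ where the series converges as the limit, as $n\to\infty$, of the cubic partial sums over $\{k\in\mathbb Z^d:\ |k_i|\le n,\ i=1,\dots,d\}$. If, moreover, $\widehat\phi$ vanishes a.e. outside $[-1/2,1/2]^d$ and $\widehat\phi(\xi)\overline{\widehat{\widetilde\phi}(\xi)}=1$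 for a.e. $\xi\in[-1/2,1/2]^d$, then for every $j\in\mathbb Z$ and every continuous function $f$ that defines a tempered distribution and whose Fourier transform is a function vanishing a.e. outside $M^{*j}[-1/2,1/2]^d$, $f$ is $N$ times continuously differentiable and (1) holds, in the same sense. -/

import Mathlib

open MeasureTheory Filter Topology SchwartzMap FourierTransform LineDeriv

noncomputable section

namespace DiffSampling

/-- The space `ℝ^d` with the Euclidean norm and inner product. -/
abbrev Space (d : ℕ) := EuclideanSpace ℝ (Fin d)

/-- The action `x ↦ A x` of a real `d × d` matrix on `ℝ^d`. -/
def mulPt {d : ℕ} (A : Matrix (Fin d) (Fin d) ℝ) (x : Space d) : Space d :=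
  Matrix.toEuclideanLin A x

/-- The integer vector `k ∈ ℤ^d` as a point of `ℝ^d`. -/
def intPt {d : ℕ} (k : Fin d → ℤ) : Space d :=
  WithLp.toLp 2 fun i => (k i : ℝ)

/-- A dilation matrix: every complex eigenvalue has modulus bigger than `1`. -/
def IsDilation {d : ℕ} (M : Matrix (Fin d) (Fin d) ℝ) : Prop :=
  ∀ μ : ℂ, Module.End.HasEigenvalue (Matrix.toLin' (M.map (fun r : ℝ => (r : ℂ)))) μ → 1 < ‖μ‖

/-- The multi-indices `β ∈ ℤ_+^d` with `β_1 + ... + β_d ≤ N`. -/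
def multiIndices (d N : ℕ) : Finset (Fin d → ℕ) :=
  (Fintype.piFinset fun _ => Finset.range (N + 1)).filter fun β => ∑ i, β i ≤ N

/-- Given first-order operators `D 0, ..., D (d-1)`, the operator
`D 0 ^ β 0 ∘ ... ∘ D (d-1) ^ β (d-1)`. -/
def multiIterate {d : ℕ} {A : Type*} (D : Fin d → A → A) (β : Fin d → ℕ) (f : A) : A :=
  (List.finRange d).foldr (fun i g => (D i)^[β i] g) f

/-- The classical derivative `D^β f` of a function. -/
def funDeriv {d : ℕ} (β : Fin d → ℕ) (f : Space d → ℂ) : Space d → ℂ :=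
  multiIterate (fun i g x => lineDeriv ℝ g x (EuclideanSpace.single i (1 : ℝ))) β f

/-- The derivative `D^β T` of a tempered distribution. -/
def distDeriv {d : ℕ} (β : Fin d → ℕ) (T : 𝓢'(Space d, ℂ)) : 𝓢'(Space d, ℂ) :=
  multiIterate (fun i S => ∂_{(EuclideanSpace.single i (1 : ℝ) : Space d)} S) β T

/-- The differential operator `L f = ∑_{[β] ≤ N} a_β D^β f`. -/
def diffOp {d : ℕ} (N : ℕ) (a : (Fin d → ℕ) → ℂ) (f : Space d → ℂ) (x : Space d) : ℂ :=
  ∑ β ∈ multiIndices d N, a β * funDeriv β f x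

/-- The tempered distribution `∑_{[β] ≤ N} conj(a_β) (-1)^{[β]} D^β δ` associated with the
differential operator `diffOp N a`. -/
def assocDist {d : ℕ} (N : ℕ) (a : (Fin d → ℕ) → ℂ) : 𝓢'(Space d, ℂ) :=
  ∑ β ∈ multiIndices d N,
    ((starRingEnd ℂ) (a β) * (-1) ^ (∑ i, β i)) •
      distDeriv β (TemperedDistribution.delta (0 : Space d))

/-- The tempered distribution `T` is (given by integration against) the function `g`. -/
def IsFunction {d : ℕ} (T : 𝓢'(Space d, ℂ)) (g : Space d → ℂ) : Prop :=
  ∀ ψ : 𝓢(Space d, ℂ), Integrable (fun x => ψ x * g x) ∧ T ψ = ∫ x, ψ x * g x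

/-- The function `f` is a tempered distribution whose Fourier transform is the function `g`. -/
def HasFourierTransform {d : ℕ} (f g : Space d → ℂ) : Prop :=
  ∃ T : 𝓢'(Space d, ℂ), IsFunction T f ∧ IsFunction (𝓕 T) g

/-- The Fourier transform of `f` is a function that vanishes almost everywhere outside `s`. -/
def FourierSupportedIn {d : ℕ} (f : Space d → ℂ) (s : Set (Space d)) : Prop :=
  ∃ g : Space d → ℂ, HasFourierTransform f g ∧ ∀ᵐ ξ, ξ ∉ s → g ξ = 0

/-- The class `𝓑`: functions `φ(x) = ∫ θ(ξ) e^{2πi(x,ξ)} dξ`, where `θ` vanishes outside a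
parallelepiped `S = [a_1,b_1] × ... × [a_d,b_d]` and `θ|_S ∈ C^d(S)`. -/
def ClassB (d : ℕ) : Set (Space d → ℂ) :=
  {φ | ∃ (a b : Fin d → ℝ) (θ : Space d → ℂ), (∀ i, a i < b i) ∧
    (∀ ξ, ξ ∉ {ξ : Space d | ∀ i, ξ i ∈ Set.Icc (a i) (b i)} → θ ξ = 0) ∧
    ContDiffOn ℝ d θ {ξ : Space d | ∀ i, ξ i ∈ Set.Icc (a i) (b i)} ∧
    ∀ x, φ x = ∫ ξ, θ ξ * Complex.exp (2 * Real.pi * Complex.I * (inner ℝ x ξ : ℝ))}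

/-- The tempered distribution `φt` and the function `φ` are strictly compatible, with the number
`δ ∈ (0, 1/2)` as a witness. -/
def StrictlyCompatibleWith {d : ℕ} (δ : ℝ) (φt : 𝓢'(Space d, ℂ)) (φ : Space d → ℂ) : Prop :=
  0 < δ ∧ δ < 1 / 2 ∧ ∃ φhat φthat : Space d → ℂ,
    HasFourierTransform φ φhat ∧ IsFunction (𝓕 φt) φthat ∧
    (∀ᵐ ξ, ‖ξ‖ < δ → (starRingEnd ℂ) (φhat ξ) * φthat ξ = 1) ∧
    ∀ l : Fin d → ℤ, l ≠ 0 → ∀ᵐ ξ, ‖intPt l - ξ‖ < δ → φhat ξ = 0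

/-- `φ_{jk}(x) = m^{j/2} φ(M^j x + k)`, `m = |det M|`. -/
def dilShift {d : ℕ} (M : Matrix (Fin d) (Fin d) ℝ) (φ : Space d → ℂ) (j : ℤ) (k : Fin d → ℤ)
    (x : Space d) : ℂ :=
  ((|M.det| ^ ((j : ℝ) / 2) : ℝ) : ℂ) * φ (mulPt (M ^ j) x + intPt k)

/-- The cubic partial sum
`m^{-j/2} ∑_{k ∈ ℤ^d, ‖k‖_∞ ≤ n} (L f(M^{-j}·))(-k) φ_{jk}(x)`, where `L = diffOp N a`. -/
def cubicSum {d : ℕ} (M : Matrix (Fin d) (Fin d) ℝ) (N : ℕ) (a : (Fin d → ℕ) → ℂ)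
    (φ : Space d → ℂ) (j : ℤ) (f : Space d → ℂ) (x : Space d) (n : ℕ) : ℂ :=
  ((|M.det| ^ (-(j : ℝ) / 2) : ℝ) : ℂ) *
    ∑ k ∈ Fintype.piFinset (fun _ : Fin d => Finset.Icc (-(n : ℤ)) (n : ℤ)),
      diffOp N a (fun y => f (mulPt (M ^ (-j)) y)) (-intPt k) * dilShift M φ j k x

/-- The cube `[-1/2, 1/2]^d`. -/
def unitCube (d : ℕ) : Set (Space d) :=
  {ξ | ∀ i, ξ i ∈ Set.Icc (-(1 / 2) : ℝ) (1 / 2)}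

end DiffSampling

end

open DiffSampling

noncomputable section

namespace DiffSampling

/-! A continuous `f` whose Fourier transform is a compactly supported function `g` equals the
inverse Fourier integral of `g` (`HasFourierTransform.eq_invFourier`). The dilate `F = f(M^{-j}·)`
therefore equals `invFourier G`, with `G` concentrated on a bounded set `U`, and `L F = invFourier
(σ G)`, where `σ` is the polynomial symbol of `L` (`diffOp_invFourier`). Likewise `φ = invFourier
θ`, and the Fourier transform of the distribution associated with `L` is the conjugate of `σ`.

Hence the cubic partial sum of `∑ L F(-k) φ(y + k)` is `∫ σ G S_n`, where `S_n(η) = ∑ e^{-2πi(k,η)}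
φ(y + k)` is a cubic partial sum of the Fourier series of the periodization of `θ(ξ) e^{2πi(y,ξ)}`.
If the `S_n` are uniformly bounded and converge a.e. to that periodization, dominated convergence
gives the limit. Where `G ≠ 0`, compatibility kills every nonzero integer translate of `θ` and makes
`σ θ = 1`, so the limit is `∫ G(η) e^{2πi(y,η)} dη = F(y)`. Taking `y = M^j x` gives `f(x)`.

The analytic core is thus `boxSum_bounded_and_tendsto`, the boundedness and convergence of `S_n` for
`θ` of class `C^d` on a box. The Dirichlet kernel is not bounded in `L_1`, but its primitive has
increments bounded uniformly in `n` on bounded intervals, and converges to a step function.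
Integrating by parts in one coordinate at a time spends one derivative per dimension. -/

/-! ### Sawtooth series: uniform bound and limit. -/

/-- The partial sums of the Fourier series of the sawtooth function. -/
def sawtoothSum (n : ℕ) (x : ℝ) : ℝ := ∑ k ∈ Finset.range n, Real.sin ((k + 1) * x) / (k + 1)

lemma exp_I_pow_im (x : ℝ) (r : ℝ) (k : ℕ) :
    (((r * Complex.exp (x * Complex.I)) ^ (k + 1) / ((k : ℂ) + 1)).im)
      = r ^ (k + 1) * Real.sin ((k + 1) * x) / (k + 1) := by
  have h : (r * Complex.exp (x * Complex.I)) ^ (k + 1) / ((k : ℂ) + 1)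
      = ((r ^ (k + 1) / (k + 1) : ℝ) : ℂ) *
        Complex.exp ((((k : ℝ) + 1) * x : ℝ) * Complex.I) := by
    rw [mul_pow, ← Complex.exp_nat_mul]
    push_cast
    rw [mul_div_right_comm, ← mul_assoc]
  rw [h, Complex.im_ofReal_mul, Complex.exp_ofReal_mul_I_im]
  ring

lemma hasSum_abel_sawtooth (x : ℝ) {r : ℝ} (h0 : 0 ≤ r) (h1 : r < 1) :
    HasSum (fun k : ℕ => r ^ (k + 1) * Real.sin ((k + 1) * x) / (k + 1))
      (-(Complex.log (1 - r * Complex.exp (x * Complex.I))).im) := by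
  have hz : ‖(r : ℂ) * Complex.exp (x * Complex.I)‖ < 1 := by
    rw [norm_mul, Complex.norm_exp_ofReal_mul_I, mul_one, Complex.norm_real, Real.norm_eq_abs,
      abs_of_nonneg h0]
    exact h1
  have := Complex.hasSum_im (Complex.hasSum_taylorSeries_neg_log' hz)
  simpa only [exp_I_pow_im, Complex.neg_im] using this

lemma abs_sin_div_le (k : ℕ) (y : ℝ) : |Real.sin y / (k + 1)| ≤ 1 / (k + 1) := by
  rw [abs_div, abs_of_pos (by positivity : (0 : ℝ) < k + 1)]
  gcongr
  exact Real.abs_sin_le_one _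

/-- Comparison with the Abel mean at radius `r = 1 - 1/n`. That mean is minus an argument, hence at
most `π` in modulus; its tail beyond `n` and its deviation from the partial sum over the first `n`
terms are each at most `1`. -/
lemma abs_sawtoothSum_le (n : ℕ) (x : ℝ) : |sawtoothSum n x| ≤ Real.pi + 2 := by
  rcases Nat.eq_zero_or_pos n with rfl | hn
  · simp [sawtoothSum]; positivity
  have hn' : (1 : ℝ) ≤ n := by exact_mod_cast hn
  set r : ℝ := 1 - 1 / n with hr
  have h0 : 0 ≤ r := by
    rw [hr, sub_nonneg, div_le_one (by linarith)]; exact hn'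
  have h1 : r < 1 := by rw [hr]; linarith [show (0 : ℝ) < 1 / n by positivity]
  have hs := hasSum_abel_sawtooth x h0 h1
  set t : ℕ → ℝ := fun k => r ^ (k + 1) * Real.sin ((k + 1) * x) / (k + 1) with ht
  have hA : |∑' k, t k| ≤ Real.pi := by
    rw [hs.tsum_eq, abs_neg, Complex.log_im]
    exact Complex.abs_arg_le_pi _
  have hsplit := hs.summable.sum_add_tsum_nat_add n
  have hB : |∑' k, t (k + n)| ≤ 1 := by
    have hg : HasSum (fun k : ℕ => (1 / (n : ℝ)) * r ^ k) ((1 / (n : ℝ)) * (1 - r)⁻¹) :=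
      (hasSum_geometric_of_lt_one h0 h1).mul_left _
    have hgv : (1 / (n : ℝ)) * (1 - r)⁻¹ = 1 := by
      rw [hr]; field_simp; ring
    rw [hgv] at hg
    rw [← Real.norm_eq_abs]
    refine tsum_of_norm_bounded hg fun k => ?_
    have : t (k + n) = r ^ (k + n + 1) * (Real.sin (((k + n : ℕ) + 1) * x) / ((k + n : ℕ) + 1)) := by
      simp only [ht]; ring
    rw [this, norm_mul, Real.norm_eq_abs, Real.norm_eq_abs, abs_of_nonneg (pow_nonneg h0 _),
      mul_comm]
    refine mul_le_mul ((abs_sin_div_le _ _).trans ?_) ?_ (by positivity) (by positivity)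
    · push_cast
      gcongr
      linarith [show (0 : ℝ) ≤ k by positivity]
    · exact pow_le_pow_of_le_one h0 h1.le (by omega)
  have hC : |sawtoothSum n x - ∑ k ∈ Finset.range n, t k| ≤ 1 := by
    rw [sawtoothSum, ← Finset.sum_sub_distrib]
    refine (Finset.abs_sum_le_sum_abs _ _).trans ?_
    have : ∀ k ∈ Finset.range n,
        |Real.sin ((k + 1) * x) / (k + 1) - t k| ≤ 1 / (n : ℝ) := by
      intro k _
      have e : Real.sin ((k + 1) * x) / (k + 1) - t k
          = (1 - r ^ (k + 1)) * (Real.sin ((k + 1) * x) / (k + 1)) := by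
        simp only [ht]; ring
      -- Bernoulli's inequality. The factor `k + 1` cancels the denominator of the term, so each of
      -- the `n` differences is at most `1/n`.
      have hb : 1 - r ^ (k + 1) ≤ ((k : ℝ) + 1) * (1 / n) := by
        have := one_add_mul_le_pow (a := r - 1) (by linarith) (k + 1)
        have e2 : (1 + (r - 1)) = r := by ring
        rw [e2] at this
        push_cast at this
        have e3 : r - 1 = -(1 / (n : ℝ)) := by rw [hr]; ring
        rw [e3] at this
        linarith
      have hb0 : 0 ≤ 1 - r ^ (k + 1) := sub_nonneg.2 (pow_le_one₀ h0 h1.le)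
      rw [e, abs_mul, abs_of_nonneg hb0]
      calc _ ≤ ((k : ℝ) + 1) * (1 / n) * (1 / (k + 1)) :=
            mul_le_mul hb (abs_sin_div_le _ _) (abs_nonneg _) (by positivity)
        _ = 1 / n := by field_simp
    refine (Finset.sum_le_sum this).trans ?_
    simp
    rw [mul_inv_cancel₀ (by linarith)]
  have : sawtoothSum n x = (sawtoothSum n x - ∑ k ∈ Finset.range n, t k)
      + (∑' k, t k) - ∑' k, t (k + n) := by rw [← hsplit]; ring
  rw [this]
  rw [abs_le] at *
  constructor <;> linarith [hA.1, hA.2, hB.1, hB.2, hC.1, hC.2]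

lemma one_sub_exp_re_pos {x : ℝ} (h0 : 0 < x) (h1 : x < 2 * Real.pi) :
    0 < (1 - Complex.exp (x * Complex.I)).re := by
  rw [Complex.sub_re, Complex.one_re, Complex.exp_ofReal_mul_I_re]
  have : Real.cos x ≠ 1 := by
    intro h
    rw [Real.cos_eq_one_iff] at h
    obtain ⟨k, hk⟩ := h
    have hp := Real.pi_pos
    rw [← hk] at h0 h1
    have h2 : (0 : ℝ) < k := by
      by_contra hh
      push Not at hh
      nlinarith
    have h3 : (k : ℝ) < 1 := by
      by_contra hh
      push Not at hh
      nlinarith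
    norm_cast at h2 h3
    omega
  have := lt_of_le_of_ne (Real.cos_le_one x) this
  linarith

/-- Polar form: `1 - e^{ix} = 2 sin(x/2) e^{i(x-π)/2}`, with positive modulus and an angle inside
the principal range. -/
lemma log_one_sub_exp_im {x : ℝ} (h0 : 0 < x) (h1 : x < 2 * Real.pi) :
    (Complex.log (1 - Complex.exp (x * Complex.I))).im = (x - Real.pi) / 2 := by
  have hs : 0 < Real.sin (x / 2) := Real.sin_pos_of_pos_of_lt_pi (by linarith) (by linarith)
  have key : 1 - Complex.exp (x * Complex.I)
      = ((2 * Real.sin (x / 2) : ℝ) : ℂ) *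
        (Real.cos ((x - Real.pi) / 2) + Real.sin ((x - Real.pi) / 2) * Complex.I) := by
    have e1 : (x - Real.pi) / 2 = x / 2 - Real.pi / 2 := by ring
    have e2 : x = 2 * (x / 2) := by ring
    rw [e1, Real.cos_sub_pi_div_two, Real.sin_sub_pi_div_two]
    apply Complex.ext
    · rw [Complex.sub_re, Complex.one_re, Complex.exp_ofReal_mul_I_re, Complex.re_ofReal_mul]
      conv_lhs => rw [e2, Real.cos_two_mul]
      rw [Complex.add_re, Complex.re_ofReal_mul, Complex.I_re,
        Complex.ofReal_re]
      nlinarith [Real.sin_sq_add_cos_sq (x / 2)]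
    · rw [Complex.sub_im, Complex.one_im, Complex.exp_ofReal_mul_I_im, Complex.im_ofReal_mul]
      conv_lhs => rw [e2, Real.sin_two_mul]
      rw [Complex.add_im, Complex.im_ofReal_mul, Complex.I_im,
        Complex.ofReal_im]
      ring
  rw [Complex.log_im, key]
  push_cast
  have := Complex.arg_mul_cos_add_sin_mul_I (r := 2 * Real.sin (x / 2))
    (θ := (x - Real.pi) / 2) (by linarith) ⟨by linarith, by linarith [Real.pi_pos]⟩
  push_cast at this
  exact this

/-- Dirichlet's test gives convergence of `∑ z^k / k` on the unit circle away from `1`; Abel's limit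
theorem identifies the sum as `-log(1 - z)`. -/
lemma tendsto_sawtoothSum {x : ℝ} (h0 : 0 < x) (h1 : x < 2 * Real.pi) :
    Tendsto (fun n => sawtoothSum n x) atTop (𝓝 ((Real.pi - x) / 2)) := by
  set z := Complex.exp (x * Complex.I) with hz
  have hre := one_sub_exp_re_pos h0 h1
  have hz1 : z ≠ 1 := by
    intro h
    rw [← hz, h] at hre
    simp at hre
  have hzn : ‖z‖ = 1 := Complex.norm_exp_ofReal_mul_I x
  have hcau : CauchySeq fun n => ∑ i ∈ Finset.range n, (1 / ((i : ℝ) + 1)) • z ^ (i + 1) := by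
    refine Antitone.cauchySeq_series_mul_of_tendsto_zero_of_bounded
      (b := 2 / ‖z - 1‖) ?_ tendsto_one_div_add_atTop_nhds_zero_nat ?_
    · intro i j hij
      have : (i : ℝ) ≤ j := by exact_mod_cast hij
      dsimp only
      gcongr
    · intro n
      have : ∑ i ∈ Finset.range n, z ^ (i + 1) = z * ((z ^ n - 1) / (z - 1)) := by
        rw [← geom_sum_eq hz1, Finset.mul_sum]
        exact Finset.sum_congr rfl fun i _ => by ring
      rw [this, norm_mul, hzn, one_mul, norm_div]
      gcongr
      refine (norm_sub_le _ _).trans ?_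
      rw [norm_pow, hzn, one_pow, norm_one]
      norm_num
  obtain ⟨l, hl⟩ := cauchySeq_tendsto_of_complete hcau
  have habel := Complex.tendsto_tsum_powerSeries_nhdsWithin_lt hl
  rw [tendsto_map'_iff] at habel
  have hlog : Tendsto (fun r : ℝ => -Complex.log (1 - r * z)) (𝓝[<] 1) (𝓝 (z * 0 + -Complex.log (1 - z))) := by
    have : ContinuousAt (fun r : ℝ => -Complex.log (1 - r * z)) 1 := by
      have h : (1 - ((1 : ℝ) : ℂ) * z) ∈ Complex.slitPlane := by
        left; rwa [Complex.ofReal_one, one_mul]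
      fun_prop (disch := exact h)
    have := this.tendsto.mono_left (nhdsWithin_le_nhds (s := Set.Iio 1))
    simpa using this
  have hl' : l = -Complex.log (1 - z) := by
    -- The coefficients are indexed from `0`, one power of `r` short of the logarithm series; the
    -- extra factor `r` tends to `1`.
    have h2 : Tendsto (fun r : ℝ => (r : ℂ) * ∑' n : ℕ, ((1 / ((n : ℝ) + 1)) • z ^ (n + 1)) * (r : ℂ) ^ n)
        (𝓝[<] 1) (𝓝 (1 * l)) := by
      refine Tendsto.mul ?_ habel
      have : ContinuousAt (fun r : ℝ => (r : ℂ)) 1 := by fun_prop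
      simpa using this.tendsto.mono_left (nhdsWithin_le_nhds (s := Set.Iio 1))
    have hev : (fun r : ℝ => (r : ℂ) * ∑' n : ℕ, ((1 / ((n : ℝ) + 1)) • z ^ (n + 1)) * (r : ℂ) ^ n)
        =ᶠ[𝓝[<] 1] fun r : ℝ => -Complex.log (1 - r * z) := by
      have : Set.Ioo (0 : ℝ) 1 ∈ 𝓝[<] (1 : ℝ) := Ioo_mem_nhdsLT one_pos
      filter_upwards [this] with r hr
      have hnorm : ‖(r : ℂ) * z‖ < 1 := by
        rw [norm_mul, hzn, mul_one, Complex.norm_real, Real.norm_eq_abs, abs_of_pos hr.1]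
        exact hr.2
      rw [← (Complex.hasSum_taylorSeries_neg_log' hnorm).tsum_eq, ← tsum_mul_left]
      refine tsum_congr fun n => ?_
      rw [Complex.real_smul]
      push_cast
      ring
    have := tendsto_nhds_unique (h2.congr' hev) hlog
    simpa using this
  rw [hl'] at hl
  have him := (Complex.continuous_im.tendsto _).comp hl
  rw [Complex.neg_im, log_one_sub_exp_im h0 h1] at him
  have e : -((x - Real.pi) / 2) = (Real.pi - x) / 2 := by ring
  rw [e] at him
  refine him.congr fun n => ?_
  simp only [Function.comp, Complex.im_sum, sawtoothSum]
  refine Finset.sum_congr rfl fun k _ => ?_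
  have := exp_I_pow_im x 1 k
  simp only [Complex.ofReal_one, one_mul, one_pow, ← hz] at this
  rw [← this, Complex.real_smul]
  push_cast
  congr 1
  ring

/-! ### The Dirichlet kernel and its primitive. -/

/-- The Dirichlet kernel of period `1`. -/
def dirichletKernel (n : ℕ) (t : ℝ) : ℝ :=
  1 + 2 * ∑ k ∈ Finset.range n, Real.cos ((k + 1) * (2 * Real.pi * t))

lemma continuous_dirichletKernel (n : ℕ) : Continuous (dirichletKernel n) := by
  unfold dirichletKernel; fun_prop

lemma sum_exp_eq_dirichletKernel (n : ℕ) (t : ℝ) :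
    ∑ k ∈ Finset.Icc (-(n : ℤ)) n, Complex.exp (2 * Real.pi * Complex.I * (k * t : ℝ))
      = dirichletKernel n t := by
  induction n with
  | zero => simp [dirichletKernel]
  | succ n ih =>
    have : Finset.Icc (-((n + 1 : ℕ) : ℤ)) ((n + 1 : ℕ) : ℤ)
        = insert (-((n : ℤ) + 1)) (insert ((n : ℤ) + 1) (Finset.Icc (-(n : ℤ)) n)) := by
      ext k; simp only [Finset.mem_Icc, Finset.mem_insert]; push_cast; omega
    rw [this, Finset.sum_insert, Finset.sum_insert, ih]
    · unfold dirichletKernel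
      rw [Finset.sum_range_succ]
      push_cast
      rw [mul_add, Complex.two_cos]
      have e1 : 2 * (Real.pi : ℂ) * Complex.I * ((-((n : ℂ) + 1)) * t)
        = -(((n : ℂ) + 1) * (2 * Real.pi * t)) * Complex.I := by ring
      have e2 : 2 * (Real.pi : ℂ) * Complex.I * (((n : ℂ) + 1) * t)
        = (((n : ℂ) + 1) * (2 * Real.pi * t)) * Complex.I := by ring
      rw [e1, e2]
      ring
    · simp
    · simp only [Finset.mem_insert, Finset.mem_Icc]; omega

/-- The primitive of the Dirichlet kernel that vanishes at the origin. -/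
def dirichletPrimitive (n : ℕ) (u : ℝ) : ℝ := u + sawtoothSum n (2 * Real.pi * u) / Real.pi

lemma hasDerivAt_dirichletPrimitive (n : ℕ) (u : ℝ) :
    HasDerivAt (dirichletPrimitive n) (dirichletKernel n u) u := by
  have h1 : ∀ k ∈ Finset.range n,
      HasDerivAt (fun u : ℝ => Real.sin (((k : ℝ) + 1) * (2 * Real.pi * u)) / (k + 1))
      (2 * Real.pi * Real.cos ((k + 1) * (2 * Real.pi * u))) u := by
    intro k _
    have h : HasDerivAt (fun u : ℝ => ((k : ℝ) + 1) * (2 * Real.pi * u))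
        (((k : ℝ) + 1) * (2 * Real.pi)) u := by
      simpa using ((hasDerivAt_id u).const_mul (2 * Real.pi)).const_mul ((k : ℝ) + 1)
    refine (h.sin.div_const ((k : ℝ) + 1)).congr_deriv ?_
    rw [div_eq_iff (by positivity)]
    ring
  have h2 := (hasDerivAt_id u).add ((HasDerivAt.fun_sum h1).div_const Real.pi)
  refine h2.congr_deriv ?_
  unfold dirichletKernel
  rw [← Finset.mul_sum]
  rw [mul_assoc, mul_div_assoc, mul_div_cancel_left₀ _ Real.pi_ne_zero]

lemma abs_dirichletPrimitive_sub_le (n : ℕ) (u v : ℝ) :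
    |dirichletPrimitive n v - dirichletPrimitive n u| ≤ |v - u| + 2 * (Real.pi + 2) / Real.pi := by
  have e : dirichletPrimitive n v - dirichletPrimitive n u = (v - u) +
      (sawtoothSum n (2 * Real.pi * v) - sawtoothSum n (2 * Real.pi * u)) / Real.pi := by
    unfold dirichletPrimitive; ring
  rw [e]
  refine (abs_add_le _ _).trans ?_
  rw [abs_div, abs_of_pos Real.pi_pos]
  gcongr
  refine (abs_sub _ _).trans ?_
  linarith [abs_sawtoothSum_le n (2 * Real.pi * v), abs_sawtoothSum_le n (2 * Real.pi * u)]

/-- The limit is a primitive of the Dirac comb. Integers must be excluded: there the sawtooth sums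
vanish and the value stays `u`. -/
lemma tendsto_dirichletPrimitive {u : ℝ} (hu : ∀ l : ℤ, u ≠ l) :
    Tendsto (fun n => dirichletPrimitive n u) atTop (𝓝 (⌊u⌋ + 1 / 2)) := by
  have h0 : 0 < Int.fract u := lt_of_le_of_ne (Int.fract_nonneg u) fun h =>
    hu ⌊u⌋ (by linarith [Int.self_sub_floor u])
  have h1 := Int.fract_lt_one u
  have hp := Real.pi_pos
  have h := tendsto_sawtoothSum (x := 2 * Real.pi * Int.fract u) (by positivity) (by nlinarith)
  have hper : ∀ n, sawtoothSum n (2 * Real.pi * u) = sawtoothSum n (2 * Real.pi * Int.fract u) := by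
    intro n
    unfold sawtoothSum
    refine Finset.sum_congr rfl fun k _ => ?_
    congr 1
    have : ((k : ℝ) + 1) * (2 * Real.pi * u)
        = (k + 1) * (2 * Real.pi * Int.fract u) + ((((k : ℤ) + 1) * ⌊u⌋ : ℤ) : ℝ) * (2 * Real.pi) := by
      push_cast
      have := Int.floor_add_fract u
      conv_lhs => rw [← this]
      ring
    rw [this, Real.sin_add_int_mul_two_pi]
  have h2 := (h.div_const Real.pi).const_add u
  have e : u + (Real.pi - 2 * Real.pi * Int.fract u) / 2 / Real.pi = ⌊u⌋ + 1 / 2 := by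
    have := Int.floor_add_fract u
    field_simp
    linear_combination (-2) * this
  rw [e] at h2
  refine h2.congr fun n => ?_
  rw [dirichletPrimitive, hper]

/-- The integers in `[u - η, v - η]` are those in the half-open interval between the floors, because
the left endpoint is not an integer. -/
lemma card_int_translates {L : Finset ℤ} {u v η : ℝ} (huv : u ≤ v)
    (hu : ∀ l : ℤ, u - η ≠ l) (hL : ∀ l : ℤ, η + l ∈ Set.Icc u v → l ∈ L) :
    ∑ l : L, Set.indicator (Set.Icc u v) (fun _ => (1 : ℝ)) (η + ((l : ℤ) : ℝ))
      = (⌊v - η⌋ : ℝ) - ⌊u - η⌋ := by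
  rw [Finset.sum_coe_sort L (fun l : ℤ => Set.indicator (Set.Icc u v) (fun _ => (1 : ℝ)) (η + (l : ℝ)))]
  have hsub : Finset.Ioc ⌊u - η⌋ ⌊v - η⌋ = L.filter fun l : ℤ => η + (l : ℝ) ∈ Set.Icc u v := by
    ext l
    rw [Finset.mem_Ioc, Finset.mem_filter, Int.floor_lt, Int.le_floor]
    constructor
    · rintro ⟨h1, h2⟩
      have : η + (l : ℝ) ∈ Set.Icc u v := ⟨by linarith, by linarith⟩
      exact ⟨hL l this, this⟩
    · rintro ⟨-, h1, h2⟩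
      exact ⟨lt_of_le_of_ne (by linarith) (hu l), by linarith⟩
  simp only [Set.indicator_apply]
  rw [← Finset.sum_filter, ← hsub, Finset.sum_const, Int.card_Ioc, nsmul_eq_mul, mul_one]
  have : (0 : ℤ) ≤ ⌊v - η⌋ - ⌊u - η⌋ := sub_nonneg.2 (Int.floor_le_floor (by linarith))
  have h2 := Int.toNat_of_nonneg this
  exact_mod_cast h2

/-! ### Box integrals against product kernels, by induction on the dimension. -/

/-- The cubic partial sum at `η` of the Fourier series of the `ℤ^d`-periodization of `g`
restricted to the box `[a, b]`. -/
def boxSum {d : ℕ} (a b η : Fin d → ℝ) (g : (Fin d → ℝ) → ℂ) (n : ℕ) : ℂ :=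
  ∫ ξ in Set.Icc a b, g ξ * ((∏ i, dirichletKernel n (ξ i - η i) : ℝ) : ℂ)

lemma contDiff_cons {d : ℕ} {E : Type} [NormedAddCommGroup E] [NormedSpace ℝ E]
    {n : WithTop ℕ∞} {s : E → ℝ} {ξ : E → Fin d → ℝ} (hs : ContDiff ℝ n s)
    (hξ : ContDiff ℝ n ξ) :
    ContDiff ℝ n fun x => (Fin.cons (s x) (ξ x) : Fin (d + 1) → ℝ) := by
  rw [contDiff_pi]
  intro i
  refine Fin.cases ?_ (fun j => ?_) i
  · simpa using hs
  · simpa using (contDiff_pi.1 hξ j)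

lemma cons_mem_Icc {d : ℕ} {a b : Fin (d + 1) → ℝ} {s : ℝ} {ξ : Fin d → ℝ} :
    (Fin.cons s ξ : Fin (d + 1) → ℝ) ∈ Set.Icc a b ↔
      s ∈ Set.Icc (a 0) (b 0) ∧ ξ ∈ Set.Icc (Fin.tail a) (Fin.tail b) := by
  simp only [Set.mem_Icc, Pi.le_def, Fin.forall_fin_succ, Fin.cons_zero, Fin.cons_succ, Fin.tail]
  tauto

lemma uniqueDiffOn_Icc_pi {d : ℕ} {a b : Fin d → ℝ} (hab : ∀ i, a i < b i) :
    UniqueDiffOn ℝ (Set.Icc a b) := by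
  rw [← Set.pi_univ_Icc]
  exact UniqueDiffOn.univ_pi fun i => uniqueDiffOn_Icc (hab i)

lemma integrable_prod_restrict_of_continuousOn {X Y : Type*} [MeasureSpace X] [MeasureSpace Y]
    [TopologicalSpace X] [TopologicalSpace Y] [OpensMeasurableSpace (X × Y)]
    [SFinite (volume : Measure X)] [SFinite (volume : Measure Y)]
    [IsFiniteMeasureOnCompacts (volume : Measure (X × Y))] [T2Space (X × Y)]
    [TopologicalSpace.PseudoMetrizableSpace (X × Y)]
    {A : Set X} {B : Set Y} (hA : IsCompact A) (hB : IsCompact B) {h : X × Y → ℂ}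
    (hh : ContinuousOn h (A ×ˢ B)) :
    Integrable h ((volume.restrict A).prod (volume.restrict B)) := by
  rw [Measure.prod_restrict]
  exact hh.integrableOn_compact (hA.prod hB)

lemma setIntegral_Icc_succ {d : ℕ} (a b : Fin (d + 1) → ℝ) {h : (Fin (d + 1) → ℝ) → ℂ}
    (hh : ContinuousOn h (Set.Icc a b)) :
    ∫ ξ in Set.Icc a b, h ξ = ∫ ξ' in Set.Icc (Fin.tail a) (Fin.tail b),
      ∫ t in Set.Icc (a 0) (b 0), h (Fin.cons t ξ') := by
  have hmp := (volume_preserving_piFinSuccAbove (fun _ : Fin (d + 1) => ℝ) 0).symm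
  rw [← hmp.setIntegral_preimage_emb (MeasurableEquiv.measurableEmbedding _)]
  have hpre : (MeasurableEquiv.piFinSuccAbove (fun _ : Fin (d + 1) => ℝ) 0).symm ⁻¹' Set.Icc a b
      = Set.Icc (a 0) (b 0) ×ˢ Set.Icc (Fin.tail a) (Fin.tail b) := by
    ext ⟨t, ξ'⟩
    have : (MeasurableEquiv.piFinSuccAbove (fun _ : Fin (d + 1) => ℝ) 0).symm (t, ξ')
      = Fin.cons t ξ' := by
      simp [MeasurableEquiv.piFinSuccAbove, Fin.consEquiv]
    rw [Set.mem_preimage, this, cons_mem_Icc, Set.mem_prod]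
  have hval : ∀ p : ℝ × (Fin d → ℝ),
      (MeasurableEquiv.piFinSuccAbove (fun _ : Fin (d + 1) => ℝ) 0).symm p = Fin.cons p.1 p.2 := by
    intro p; simp [MeasurableEquiv.piFinSuccAbove, Fin.consEquiv]
  rw [hpre]
  simp_rw [hval]
  have hc : ContinuousOn (fun p : ℝ × (Fin d → ℝ) => h (Fin.cons p.1 p.2))
      (Set.Icc (a 0) (b 0) ×ˢ Set.Icc (Fin.tail a) (Fin.tail b)) := by
    refine hh.comp (Continuous.continuousOn ?_) fun p hp => cons_mem_Icc.2 hp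
    exact (contDiff_cons (n := 0) contDiff_fst contDiff_snd).continuous
  have hint := integrable_prod_restrict_of_continuousOn isCompact_Icc isCompact_Icc hc
  rw [Measure.volume_eq_prod, ← Measure.prod_restrict, integral_prod_symm _ hint]

/-- For `τ` in `[a, b]` the indicator restricts the integral to `s ≥ τ`, where the fundamental
theorem of calculus gives `u b - u τ`. This undoes the integration by parts after the passage to the
limit. -/
lemma setIntegral_indicator_eq_sub {a b : ℝ} {u u' : ℝ → ℂ}
    (hu : ∀ t ∈ Set.Icc a b, HasDerivWithinAt u (u' t) (Set.Icc a b) t)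
    (hu' : ContinuousOn u' (Set.Icc a b)) (τ : ℝ) :
    IntegrableOn (fun s => (((Set.Icc a s).indicator (fun _ => (1 : ℝ)) τ : ℝ) : ℂ) * u' s)
      (Set.Icc a b) ∧
    (((Set.Icc a b).indicator (fun _ => (1 : ℝ)) τ : ℝ) : ℂ) * u b -
      ∫ s in Set.Icc a b, (((Set.Icc a s).indicator (fun _ => (1 : ℝ)) τ : ℝ) : ℂ) * u' s
      = (Set.Icc a b).indicator u τ := by
  by_cases hτ : τ ∈ Set.Icc a b
  · have e1 : Set.EqOn (fun s => (((Set.Icc a s).indicator (fun _ => (1 : ℝ)) τ : ℝ) : ℂ) * u' s)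
        ((Set.Icc τ b).indicator u') (Set.Icc a b) := by
      intro s hs
      by_cases h : τ ≤ s
      · have h1 : τ ∈ Set.Icc a s := ⟨hτ.1, h⟩
        have h2 : s ∈ Set.Icc τ b := ⟨h, hs.2⟩
        simp [Set.indicator_of_mem h1, Set.indicator_of_mem h2]
      · have h1 : τ ∉ Set.Icc a s := fun h' => h h'.2
        have h2 : s ∉ Set.Icc τ b := fun h' => h h'.1
        simp [Set.indicator_of_notMem h1, Set.indicator_of_notMem h2]
    have hsub : Set.Icc τ b ⊆ Set.Icc a b := Set.Icc_subset_Icc_left hτ.1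
    have hio : IntegrableOn u' (Set.Icc a b) := hu'.integrableOn_Icc
    refine ⟨(hio.indicator measurableSet_Icc).congr_fun e1.symm measurableSet_Icc, ?_⟩
    rw [setIntegral_congr_fun measurableSet_Icc e1, setIntegral_indicator measurableSet_Icc,
      Set.inter_eq_self_of_subset_right hsub, integral_Icc_eq_integral_Ioc,
      ← intervalIntegral.integral_of_le hτ.2,
      intervalIntegral.integral_eq_sub_of_hasDerivAt_of_le hτ.2
        (fun t ht => ((hu t (hsub ht)).continuousWithinAt.mono hsub))
        (fun t ht => (hu t (hsub (Set.Ioo_subset_Icc_self ht))).hasDerivAt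
          (Icc_mem_nhds (lt_of_le_of_lt hτ.1 ht.1) ht.2))
        ((hu'.mono hsub).intervalIntegrable_of_Icc hτ.2)]
    simp [Set.indicator_of_mem hτ]
  · have e1 : Set.EqOn (fun s => (((Set.Icc a s).indicator (fun _ => (1 : ℝ)) τ : ℝ) : ℂ) * u' s)
        (fun _ => 0) (Set.Icc a b) := by
      intro s hs
      have h1 : τ ∉ Set.Icc a s := fun h' => hτ ⟨h'.1, h'.2.trans hs.2⟩
      simp [Set.indicator_of_notMem h1]
    refine ⟨integrableOn_zero.congr_fun e1.symm measurableSet_Icc, ?_⟩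
    rw [setIntegral_congr_fun measurableSet_Icc e1]
    simp [Set.indicator_of_notMem hτ]

section Step

variable {d : ℕ} {E : Type} [NormedAddCommGroup E] [NormedSpace ℝ E]

/-- The partial derivative in the first coordinate of the box. -/
def headDeriv (K : Set E) (a b : Fin (d + 1) → ℝ) (Θ : E × (Fin (d + 1) → ℝ) → ℂ)
    (p : (E × ℝ) × (Fin d → ℝ)) : ℂ :=
  fderivWithin ℝ Θ (K ×ˢ Set.Icc a b) (p.1.1, Fin.cons p.1.2 p.2) (0, Pi.single 0 1)

variable {K : Set E} {a b : Fin (d + 1) → ℝ} {Θ : E × (Fin (d + 1) → ℝ) → ℂ}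

/-- The differentiated coordinate joins the parameters, so one order of smoothness is lost together
with one dimension. This is the form the induction hypothesis requires. -/
lemma contDiffOn_headDeriv (hK : UniqueDiffOn ℝ K) (hab : ∀ i, a i < b i)
    (hΘ : ContDiffOn ℝ (d + 1 : ℕ) Θ (K ×ˢ Set.Icc a b)) :
    ContDiffOn ℝ d (headDeriv K a b Θ)
      ((K ×ˢ Set.Icc (a 0) (b 0)) ×ˢ Set.Icc (Fin.tail a) (Fin.tail b)) := by
  have h1 : ContDiffOn ℝ d (fderivWithin ℝ Θ (K ×ˢ Set.Icc a b)) (K ×ˢ Set.Icc a b) :=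
    hΘ.fderivWithin (hK.prod (uniqueDiffOn_Icc_pi hab)) (by push_cast; exact le_rfl)
  have h2 : ContDiffOn ℝ d
      (fun p : (E × ℝ) × (Fin d → ℝ) => (p.1.1, (Fin.cons p.1.2 p.2 : Fin (d + 1) → ℝ)))
      ((K ×ˢ Set.Icc (a 0) (b 0)) ×ˢ Set.Icc (Fin.tail a) (Fin.tail b)) :=
    (contDiff_fst.fst.prodMk (contDiff_cons contDiff_fst.snd contDiff_snd)).contDiffOn
  have h3 := h1.comp h2 fun p hp => ⟨hp.1.1, cons_mem_Icc.2 ⟨hp.1.2, hp.2⟩⟩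
  exact h3.clm_apply contDiffOn_const

lemma hasDerivWithinAt_headDeriv
    (hΘ : ContDiffOn ℝ (d + 1 : ℕ) Θ (K ×ˢ Set.Icc a b)) {x : E} (hx : x ∈ K)
    {ξ : Fin d → ℝ} (hξ : ξ ∈ Set.Icc (Fin.tail a) (Fin.tail b)) {t : ℝ}
    (ht : t ∈ Set.Icc (a 0) (b 0)) :
    HasDerivWithinAt (fun s => Θ (x, Fin.cons s ξ)) (headDeriv K a b Θ ((x, t), ξ))
      (Set.Icc (a 0) (b 0)) t := by
  have h1 := (hΘ.differentiableOn (by simp) (x, Fin.cons t ξ)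
    ⟨hx, cons_mem_Icc.2 ⟨ht, hξ⟩⟩).hasFDerivWithinAt
  have h2 : HasDerivAt (fun s : ℝ => (x, (Fin.cons s ξ : Fin (d + 1) → ℝ)))
      ((0 : E), (Pi.single 0 1 : Fin (d + 1) → ℝ)) t := by
    refine (hasDerivAt_const t x).prodMk (hasDerivAt_pi.2 fun i => ?_)
    refine Fin.cases ?_ (fun j => ?_) i
    · simpa using! hasDerivAt_id t
    · simpa using hasDerivAt_const t (ξ j)
  exact h1.comp_hasDerivWithinAt (t := K ×ˢ Set.Icc a b) t h2.hasDerivWithinAt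
    fun s hs => ⟨hx, cons_mem_Icc.2 ⟨hs, hξ⟩⟩

/-- The increment of the primitive of the shifted Dirichlet kernel. -/
def primitiveIncrement (n : ℕ) (u η v : ℝ) : ℝ :=
  dirichletPrimitive n (v - η) - dirichletPrimitive n (u - η)

lemma hasDerivAt_primitiveIncrement (n : ℕ) (u η v : ℝ) :
    HasDerivAt (fun v => (primitiveIncrement n u η v : ℂ)) (dirichletKernel n (v - η) : ℂ) v :=
  (((hasDerivAt_dirichletPrimitive n (v - η)).comp_sub_const v η).sub_const _).ofReal_comp

lemma abs_primitiveIncrement_le {u v w : ℝ} (n : ℕ) (η : ℝ) (hv : v ∈ Set.Icc u w) :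
    |primitiveIncrement n u η v| ≤ (w - u) + 2 * (Real.pi + 2) / Real.pi := by
  refine (abs_dirichletPrimitive_sub_le n _ _).trans ?_
  have : v - η - (u - η) = v - u := by ring
  rw [this, abs_of_nonneg (by linarith [hv.1])]
  linarith [hv.2]

lemma tendsto_primitiveIncrement {L : Finset ℤ} {u v η : ℝ} (huv : u ≤ v)
    (hu : ∀ l : ℤ, u - η ≠ l) (hv : ∀ l : ℤ, v - η ≠ l)
    (hL : ∀ l : ℤ, η + l ∈ Set.Icc u v → l ∈ L) :
    Tendsto (fun n => (primitiveIncrement n u η v : ℂ)) atTop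
      (𝓝 (∑ l : L, ((Set.indicator (Set.Icc u v) (fun _ => (1 : ℝ)) (η + ((l : ℤ) : ℝ)) : ℝ) : ℂ))) := by
  have h := (tendsto_dirichletPrimitive hv).sub (tendsto_dirichletPrimitive hu)
  have e : (⌊v - η⌋ : ℝ) + 1 / 2 - (⌊u - η⌋ + 1 / 2)
      = ∑ l : L, Set.indicator (Set.Icc u v) (fun _ => (1 : ℝ)) (η + ((l : ℤ) : ℝ)) := by
    rw [card_int_translates huv hu hL]; ring
  rw [e] at h
  have := (Complex.continuous_ofReal.tendsto _).comp h
  rw [Complex.ofReal_sum] at this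
  exact this

/-- Fubini and integration by parts in coordinate `0`. The primitive is normalized to vanish at `a
0`, so only the boundary term at `b 0` survives. The measurability clause serves the later dominated
convergence. -/
lemma boxSum_succ (hK : UniqueDiffOn ℝ K) (hab : ∀ i, a i < b i)
    (hΘ : ContDiffOn ℝ (d + 1 : ℕ) Θ (K ×ˢ Set.Icc a b)) {x : E} (hx : x ∈ K)
    (η : Fin (d + 1) → ℝ) (n : ℕ) :
    boxSum a b η (fun ξ => Θ (x, ξ)) n =
      primitiveIncrement n (a 0) (η 0) (b 0) *
        boxSum (Fin.tail a) (Fin.tail b) (Fin.tail η) (fun ξ => Θ (x, Fin.cons (b 0) ξ)) n -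
      ∫ s in Set.Icc (a 0) (b 0), primitiveIncrement n (a 0) (η 0) s *
        boxSum (Fin.tail a) (Fin.tail b) (Fin.tail η) (fun ξ => headDeriv K a b Θ ((x, s), ξ)) n
    ∧ AEStronglyMeasurable (fun s => (primitiveIncrement n (a 0) (η 0) s : ℂ) *
        boxSum (Fin.tail a) (Fin.tail b) (Fin.tail η) (fun ξ => headDeriv K a b Θ ((x, s), ξ)) n)
      (volume.restrict (Set.Icc (a 0) (b 0))) := by
  set P : (Fin d → ℝ) → ℂ := fun ξ => ((∏ i, dirichletKernel n (ξ i - Fin.tail η i) : ℝ) : ℂ)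
    with hP
  have hPc : Continuous P := by
    refine Complex.continuous_ofReal.comp (continuous_finsetProd _ fun i _ => ?_)
    exact (continuous_dirichletKernel n).comp (by fun_prop)
  have hv : Continuous fun s => (primitiveIncrement n (a 0) (η 0) s : ℂ) :=
    continuous_iff_continuousAt.2 fun s => (hasDerivAt_primitiveIncrement n _ _ s).continuousAt
  have hG : ContinuousOn (fun ξ => Θ (x, ξ)) (Set.Icc a b) :=
    hΘ.continuousOn.comp (by fun_prop) fun ξ hξ => ⟨hx, hξ⟩
  have hH : ContinuousOn (fun p : ℝ × (Fin d → ℝ) => headDeriv K a b Θ ((x, p.1), p.2))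
      (Set.Icc (a 0) (b 0) ×ˢ Set.Icc (Fin.tail a) (Fin.tail b)) :=
    (contDiffOn_headDeriv hK hab hΘ).continuousOn.comp (by fun_prop)
      fun p hp => ⟨⟨hx, hp.1⟩, hp.2⟩
  have hQ : ContinuousOn (fun p : ℝ × (Fin d → ℝ) => (primitiveIncrement n (a 0) (η 0) p.1 : ℂ) *
      (headDeriv K a b Θ ((x, p.1), p.2) * P p.2))
      (Set.Icc (a 0) (b 0) ×ˢ Set.Icc (Fin.tail a) (Fin.tail b)) :=
    (hv.comp continuous_fst).continuousOn.mul (hH.mul (hPc.comp continuous_snd).continuousOn)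
  have hQi := integrable_prod_restrict_of_continuousOn isCompact_Icc isCompact_Icc hQ
  have e3 : ∀ s, (primitiveIncrement n (a 0) (η 0) s : ℂ) *
      boxSum (Fin.tail a) (Fin.tail b) (Fin.tail η) (fun ξ => headDeriv K a b Θ ((x, s), ξ)) n
      = ∫ ξ in Set.Icc (Fin.tail a) (Fin.tail b), (primitiveIncrement n (a 0) (η 0) s : ℂ) *
          (headDeriv K a b Θ ((x, s), ξ) * P ξ) := by
    intro s
    rw [boxSum, ← integral_const_mul]
  refine ⟨?_, ?_⟩
  swap
  · simp_rw [e3]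
    exact hQi.integral_prod_left.aestronglyMeasurable
  simp_rw [e3]
  rw [integral_integral_swap hQi, boxSum, setIntegral_Icc_succ, boxSum, ← integral_const_mul,
    ← integral_sub]
  · refine setIntegral_congr_fun measurableSet_Icc fun ξ hξ => ?_
    have hle := (hab 0).le
    have hibp := intervalIntegral.integral_mul_deriv_eq_deriv_mul_of_hasDerivWithinAt
      (a := a 0) (b := b 0) (u := fun s => Θ (x, Fin.cons s ξ))
      (u' := fun s => headDeriv K a b Θ ((x, s), ξ))
      (v := fun s => (primitiveIncrement n (a 0) (η 0) s : ℂ))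
      (v' := fun s => (dirichletKernel n (s - η 0) : ℂ))
      (by rw [Set.uIcc_of_le hle]; exact fun t ht => hasDerivWithinAt_headDeriv hΘ hx hξ ht)
      (fun t _ => (hasDerivAt_primitiveIncrement n _ _ t).hasDerivWithinAt)
      (ContinuousOn.intervalIntegrable_of_Icc hle
        (hH.comp (f := fun s : ℝ => (s, ξ)) (by fun_prop) fun s hs => ⟨hs, hξ⟩))
      ((Complex.continuous_ofReal.comp
        ((continuous_dirichletKernel n).comp (by fun_prop))).intervalIntegrable _ _)
    have e0 : (primitiveIncrement n (a 0) (η 0) (a 0) : ℂ) = 0 := by simp [primitiveIncrement]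
    rw [e0, mul_zero, sub_zero, intervalIntegral.integral_of_le hle,
      intervalIntegral.integral_of_le hle, ← integral_Icc_eq_integral_Ioc,
      ← integral_Icc_eq_integral_Ioc] at hibp
    have e1 : ∀ t, Θ (x, Fin.cons t ξ) * ((∏ i, dirichletKernel n
        ((Fin.cons t ξ : Fin (d + 1) → ℝ) i - η i) : ℝ) : ℂ)
        = (Θ (x, Fin.cons t ξ) * (dirichletKernel n (t - η 0) : ℂ)) * P ξ := by
      intro t
      rw [Fin.prod_univ_succ]
      simp only [hP, Fin.cons_zero, Fin.cons_succ, Fin.tail]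
      push_cast
      ring
    have e2 : ∀ s, (primitiveIncrement n (a 0) (η 0) s : ℂ) * (headDeriv K a b Θ ((x, s), ξ) * P ξ)
        = (headDeriv K a b Θ ((x, s), ξ) * (primitiveIncrement n (a 0) (η 0) s : ℂ)) * P ξ := by
      intro s; ring
    simp_rw [e1, e2]
    rw [integral_mul_const, integral_mul_const, hibp]
    ring
  · refine Integrable.const_mul ?_ _
    refine ContinuousOn.integrableOn_compact isCompact_Icc (ContinuousOn.mul ?_ hPc.continuousOn)
    refine hG.comp (Continuous.continuousOn ?_)
      fun ξ hξ => cons_mem_Icc.2 ⟨Set.right_mem_Icc.2 (hab 0).le, hξ⟩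
    exact (contDiff_cons (n := 0) contDiff_const contDiff_id).continuous
  · exact hQi.integral_prod_right
  · refine hG.mul (Continuous.continuousOn ?_)
    refine Complex.continuous_ofReal.comp (continuous_finsetProd _ fun i _ => ?_)
    exact (continuous_dirichletKernel n).comp (by fun_prop)

end Step

lemma boxSum_zero (a b η : Fin 0 → ℝ) (g : (Fin 0 → ℝ) → ℂ) (n : ℕ) :
    boxSum a b η g n = g 0 := by
  have h : Set.Icc a b = {0} := by
    ext x; simp [Subsingleton.elim x 0, Subsingleton.elim a 0, Subsingleton.elim b 0]
  have h2 : (volume : Measure (Fin 0 → ℝ)) = Measure.dirac 0 := by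
    rw [volume_pi, Measure.pi_of_empty _ 0]
  rw [boxSum, h, h2]
  simp

/-- Uniform boundedness and convergence of the cubic partial sums of the Fourier series of a
periodized piecewise smooth function which depends on a parameter in a compact set. -/
theorem boxSum_bounded_and_tendsto (d : ℕ) : ∀ (E : Type) [NormedAddCommGroup E] [NormedSpace ℝ E]
    (K : Set E), IsCompact K → UniqueDiffOn ℝ K → ∀ a b : Fin d → ℝ, (∀ i, a i < b i) →
    ∀ Θ : E × (Fin d → ℝ) → ℂ, ContDiffOn ℝ d Θ (K ×ˢ Set.Icc a b) →
    (∃ C : ℝ, ∀ x ∈ K, ∀ n η, ‖boxSum a b η (fun ξ => Θ (x, ξ)) n‖ ≤ C) ∧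
    ∀ x ∈ K, ∀ η : Fin d → ℝ, (∀ i, ∀ l : ℤ, a i - η i ≠ l ∧ b i - η i ≠ l) →
    ∀ L : Finset ℤ, (∀ i, ∀ l : ℤ, η i + l ∈ Set.Icc (a i) (b i) → l ∈ L) →
    Tendsto (boxSum a b η (fun ξ => Θ (x, ξ))) atTop
      (𝓝 (∑ l : Fin d → L, (Set.Icc a b).indicator (fun ξ => Θ (x, ξ))
        (fun i => η i + ((l i : ℤ) : ℝ)))) := by
  -- The parameter space varies in the induction. After integration by parts, the boundary term
  -- keeps `K`, while the derivative term has parameters in `K × [a 0, b 0]`; compactness keeps the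
  -- bound uniform in the parameter.
  induction d with
  | zero =>
    intro E _ _ K hK hKu a b hab Θ hΘ
    have hz : ∀ x ∈ K, ((x, 0) : E × (Fin 0 → ℝ)) ∈ K ×ˢ Set.Icc a b := fun x hx =>
      ⟨hx, by simp [Set.mem_Icc]⟩
    refine ⟨?_, ?_⟩
    · have hc : ContinuousOn (fun x => Θ (x, 0)) K :=
        hΘ.continuousOn.comp (by fun_prop) hz
      obtain ⟨C, hC⟩ := hK.exists_bound_of_continuousOn hc
      exact ⟨C, fun x hx n η => by rw [boxSum_zero]; exact hC x hx⟩
    · intro x hx η _ L _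
      have : (fun n => boxSum a b η (fun ξ => Θ (x, ξ)) n) = fun _ => Θ (x, 0) :=
        funext fun n => boxSum_zero _ _ _ _ _
      change Tendsto (fun n => boxSum a b η (fun ξ => Θ (x, ξ)) n) _ _
      rw [this]
      have h0 : (fun i : Fin 0 => η i + (((default : Fin 0 → L) i : ℤ) : ℝ)) = 0 :=
        Subsingleton.elim _ _
      rw [Fintype.sum_unique, h0, Set.indicator_of_mem (hz x hx).2]
      exact tendsto_const_nhds
  | succ d ih =>
    intro E _ _ K hK hKu a b hab Θ hΘ
    have hle := (hab 0).le
    have hab' : ∀ i, Fin.tail a i < Fin.tail b i := fun i => hab i.succ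
    have hΘ1 : ContDiffOn ℝ d (fun p : E × (Fin d → ℝ) => Θ (p.1, Fin.cons (b 0) p.2))
        (K ×ˢ Set.Icc (Fin.tail a) (Fin.tail b)) := by
      refine (hΘ.of_le (by exact_mod_cast Nat.le_succ d)).comp
        (contDiff_fst.prodMk (contDiff_cons contDiff_const contDiff_snd)).contDiffOn
        fun p hp => ⟨hp.1, cons_mem_Icc.2 ⟨Set.right_mem_Icc.2 hle, hp.2⟩⟩
    obtain ⟨⟨C1, hC1⟩, hlim1⟩ := ih E K hK hKu _ _ hab' _ hΘ1
    obtain ⟨⟨C2, hC2⟩, hlim2⟩ := ih (E × ℝ) (K ×ˢ Set.Icc (a 0) (b 0)) (hK.prod isCompact_Icc)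
      (hKu.prod (uniqueDiffOn_Icc (hab 0))) _ _ hab' _ (contDiffOn_headDeriv hKu hab hΘ)
    set C3 : ℝ := (b 0 - a 0) + 2 * (Real.pi + 2) / Real.pi with hC3
    have hC3' : ∀ n η, ∀ s ∈ Set.Icc (a 0) (b 0),
        ‖(primitiveIncrement n (a 0) η s : ℂ)‖ ≤ C3 := fun n η s hs => by
      rw [Complex.norm_real, Real.norm_eq_abs]; exact abs_primitiveIncrement_le n η hs
    have hC30 : 0 ≤ C3 := by
      have := Real.pi_pos
      have : 0 ≤ b 0 - a 0 := sub_nonneg.2 hle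
      positivity
    have hbd : ∀ x ∈ K, ∀ n (η : Fin (d + 1) → ℝ), ∀ s ∈ Set.Icc (a 0) (b 0),
        ‖(primitiveIncrement n (a 0) (η 0) s : ℂ) * boxSum (Fin.tail a) (Fin.tail b) (Fin.tail η)
          (fun ξ => headDeriv K a b Θ ((x, s), ξ)) n‖ ≤ C3 * C2 := by
      intro x hx n η s hs
      rw [norm_mul]
      exact mul_le_mul (hC3' n _ s hs) (hC2 (x, s) ⟨hx, hs⟩ n _) (norm_nonneg _) hC30
    refine ⟨⟨C3 * C1 + C3 * C2 * (b 0 - a 0), ?_⟩, ?_⟩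
    · intro x hx n η
      rw [(boxSum_succ hKu hab hΘ hx η n).1]
      refine (norm_sub_le _ _).trans (add_le_add ?_ ?_)
      · rw [norm_mul]
        exact mul_le_mul (hC3' n _ _ (Set.right_mem_Icc.2 hle)) (hC1 x hx n _) (norm_nonneg _) hC30
      · refine (norm_setIntegral_le_of_norm_le_const isCompact_Icc.measure_lt_top
          (hbd x hx n η)).trans (le_of_eq ?_)
        rw [Measure.real, Real.volume_Icc, ENNReal.toReal_ofReal (sub_nonneg.2 hle)]
    · intro x hx η hη L hL
      have hη' : ∀ i, ∀ l : ℤ, Fin.tail a i - Fin.tail η i ≠ l ∧ Fin.tail b i - Fin.tail η i ≠ l :=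
        fun i => hη i.succ
      have hL' : ∀ i, ∀ l : ℤ, Fin.tail η i + l ∈ Set.Icc (Fin.tail a i) (Fin.tail b i) → l ∈ L :=
        fun i => hL i.succ
      have hLs : ∀ s ∈ Set.Icc (a 0) (b 0), ∀ l : ℤ, η 0 + l ∈ Set.Icc (a 0) s → l ∈ L :=
        fun s hs l hl => hL 0 l ⟨hl.1, hl.2.trans hs.2⟩
      have hA := (tendsto_primitiveIncrement (L := L) hle (fun l => (hη 0 l).1)
        (fun l => (hη 0 l).2) (hL 0)).mul (hlim1 x hx (Fin.tail η) hη' L hL')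
      have hB : Tendsto (fun n => ∫ s in Set.Icc (a 0) (b 0),
          (primitiveIncrement n (a 0) (η 0) s : ℂ) * boxSum (Fin.tail a) (Fin.tail b) (Fin.tail η)
            (fun ξ => headDeriv K a b Θ ((x, s), ξ)) n) atTop
          (𝓝 (∫ s in Set.Icc (a 0) (b 0),
            (∑ l : L, (((Set.Icc (a 0) s).indicator (fun _ => (1 : ℝ)) (η 0 + ((l : ℤ) : ℝ)) : ℝ) : ℂ))
            * ∑ l : Fin d → L, (Set.Icc (Fin.tail a) (Fin.tail b)).indicator
              (fun ξ => headDeriv K a b Θ ((x, s), ξ))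
              (fun i => Fin.tail η i + ((l i : ℤ) : ℝ)))) := by
        refine tendsto_integral_of_dominated_convergence (fun _ => C3 * C2)
          (fun n => (boxSum_succ hKu hab hΘ hx η n).2) (integrable_const _)
          (fun n => ?_) ?_
        · filter_upwards [ae_restrict_mem measurableSet_Icc] with s hs using hbd x hx n η s hs
        -- The upper endpoint `s` is now a variable of integration; the values with `s - η 0` an
        -- integer, where the limit of the primitive fails, form a null set.
        · have hcount : (Set.range fun l : ℤ => η 0 + (l : ℝ)).Countable := Set.countable_range _
          filter_upwards [ae_restrict_mem measurableSet_Icc,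
            ae_restrict_of_ae (hcount.ae_notMem volume)] with s hs hs'
          refine (tendsto_primitiveIncrement hs.1 (fun l => (hη 0 l).1) (fun l h => hs' ⟨l, ?_⟩)
            (hLs s hs)).mul (hlim2 (x, s) ⟨hx, hs⟩ (Fin.tail η) hη' L hL')
          dsimp only
          linarith
      have hAB := hA.sub hB
      refine (Tendsto.congr (fun n => ((boxSum_succ hKu hab hΘ hx η n).1).symm) hAB).trans
        (le_of_eq (congrArg 𝓝 ?_))
      -- Translate by translate, the two limits recombine into the value of the original function at
      -- the translated point.
      have hterm : ∀ (l0 : L) (l : Fin d → L),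
          IntegrableOn (fun s =>
            (((Set.Icc (a 0) s).indicator (fun _ => (1 : ℝ)) (η 0 + ((l0 : ℤ) : ℝ)) : ℝ) : ℂ) *
            (Set.Icc (Fin.tail a) (Fin.tail b)).indicator
              (fun ξ => headDeriv K a b Θ ((x, s), ξ)) (fun i => Fin.tail η i + ((l i : ℤ) : ℝ)))
            (Set.Icc (a 0) (b 0)) ∧
          (((Set.Icc (a 0) (b 0)).indicator (fun _ => (1 : ℝ)) (η 0 + ((l0 : ℤ) : ℝ)) : ℝ) : ℂ) *
            (Set.Icc (Fin.tail a) (Fin.tail b)).indicator (fun ξ => Θ (x, Fin.cons (b 0) ξ))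
              (fun i => Fin.tail η i + ((l i : ℤ) : ℝ)) -
          ∫ s in Set.Icc (a 0) (b 0),
            (((Set.Icc (a 0) s).indicator (fun _ => (1 : ℝ)) (η 0 + ((l0 : ℤ) : ℝ)) : ℝ) : ℂ) *
            (Set.Icc (Fin.tail a) (Fin.tail b)).indicator
              (fun ξ => headDeriv K a b Θ ((x, s), ξ)) (fun i => Fin.tail η i + ((l i : ℤ) : ℝ))
          = (Set.Icc a b).indicator (fun ξ => Θ (x, ξ))
            (Fin.cons (η 0 + ((l0 : ℤ) : ℝ)) fun i => Fin.tail η i + ((l i : ℤ) : ℝ)) := by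
        intro l0 l
        set τ := η 0 + ((l0 : ℤ) : ℝ)
        set ξ : Fin d → ℝ := fun i => Fin.tail η i + ((l i : ℤ) : ℝ)
        by_cases hξ : ξ ∈ Set.Icc (Fin.tail a) (Fin.tail b)
        · simp only [Set.indicator_of_mem hξ]
          have := setIntegral_indicator_eq_sub
            (fun t ht => hasDerivWithinAt_headDeriv hΘ hx hξ ht)
            ((contDiffOn_headDeriv hKu hab hΘ).continuousOn.comp
              (f := fun s : ℝ => ((x, s), ξ)) (by fun_prop) fun s hs => ⟨⟨hx, hs⟩, hξ⟩) τ
          refine ⟨this.1, this.2.trans ?_⟩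
          by_cases hτ : τ ∈ Set.Icc (a 0) (b 0)
          · rw [Set.indicator_of_mem hτ, Set.indicator_of_mem (cons_mem_Icc.2 ⟨hτ, hξ⟩)]
          · rw [Set.indicator_of_notMem hτ,
              Set.indicator_of_notMem fun h => hτ (cons_mem_Icc.1 h).1]
        · simp only [Set.indicator_of_notMem hξ, mul_zero, integral_zero, sub_zero]
          refine ⟨integrableOn_zero, ?_⟩
          rw [Set.indicator_of_notMem fun h => hξ (cons_mem_Icc.1 h).2]
      simp_rw [Finset.sum_mul_sum]
      rw [integral_finsetSum _ fun l0 _ => integrable_finsetSum _ fun l _ => (hterm l0 l).1,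
        ← Finset.sum_sub_distrib]
      rw [← (Fin.consEquiv fun _ : Fin (d + 1) => L).sum_comp, Fintype.sum_prod_type]
      refine Finset.sum_congr rfl fun l0 _ => ?_
      rw [integral_finsetSum _ fun l _ => (hterm l0 l).1, ← Finset.sum_sub_distrib]
      refine Finset.sum_congr rfl fun l _ => (hterm l0 l).2.trans ?_
      congr 1
      ext i
      refine Fin.cases ?_ (fun j => ?_) i
      · simp [Fin.consEquiv]
      · simp [Fin.consEquiv, Fin.tail]

/-! ### Inverse Fourier integrals and tempered distributions. -/

variable {d : ℕ}

/-- The inverse Fourier integral `∫ g(ξ) e^{2πi(x,ξ)} dξ`. -/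
def invFourier (g : Space d → ℂ) (x : Space d) : ℂ :=
  ∫ ξ, g ξ * Complex.exp (2 * Real.pi * Complex.I * (inner ℝ x ξ : ℝ))

lemma invFourier_eq (g : Space d → ℂ) : invFourier g = 𝓕⁻ g := by
  ext x
  rw [Real.fourierInv_eq', invFourier]
  refine integral_congr_ae (Eventually.of_forall fun ξ => ?_)
  dsimp only
  rw [smul_eq_mul, mul_comm, real_inner_comm]
  congr 2
  push_cast
  ring

lemma norm_exp_two_pi_I (t : ℝ) : ‖Complex.exp (2 * Real.pi * Complex.I * (t : ℝ))‖ = 1 := by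
  have : 2 * (Real.pi : ℂ) * Complex.I * (t : ℝ) = ((2 * Real.pi * t : ℝ) : ℂ) * Complex.I := by
    push_cast; ring
  rw [this, Complex.norm_exp_ofReal_mul_I]

lemma integrable_mul_exp {g : Space d → ℂ} (hg : Integrable g) (x : Space d) :
    Integrable fun ξ => g ξ * Complex.exp (2 * Real.pi * Complex.I * (inner ℝ x ξ : ℝ)) := by
  refine hg.mul_bdd (c := 1) (Continuous.aestronglyMeasurable (by fun_prop))
    (Eventually.of_forall fun ξ => (norm_exp_two_pi_I _).le)

/-- The transform moves from one factor to the other by Fubini, and Fourier inversion on Schwartz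
functions finishes. In distributional terms, `invFourier g` has Fourier transform `g`. -/
lemma integral_fourier_mul_invFourier {g : Space d → ℂ} (hg : Integrable g)
    (ψ : 𝓢(Space d, ℂ)) : ∫ x, (𝓕 ψ) x * invFourier g x = ∫ ξ, ψ ξ * g ξ := by
  rw [invFourier_eq, Real.fourierInv_eq_fourier_comp_neg]
  have h := VectorFourier.integral_fourierIntegral_smul_eq_flip (μ := volume) (ν := volume)
    (L := innerₗ (Space d)) (e := Real.fourierChar) (f := ((𝓕 ψ : 𝓢(Space d, ℂ)) : Space d → ℂ)) (g := fun x => g (-x))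
    Real.continuous_fourierChar continuous_inner (𝓕 ψ : 𝓢(Space d, ℂ)).integrable hg.comp_neg
  rw [flip_innerₗ] at h
  simp only [smul_eq_mul] at h
  refine h.symm.trans ?_
  have e : ∀ ξ : Space d, VectorFourier.fourierIntegral Real.fourierChar volume
      (innerₗ (Space d)) ((𝓕 ψ : 𝓢(Space d, ℂ)) : Space d → ℂ) ξ = ψ (-ξ) := by
    intro ξ
    change 𝓕 ((𝓕 ψ : 𝓢(Space d, ℂ)) : Space d → ℂ) ξ = _
    have : 𝓕 ((𝓕 ψ : 𝓢(Space d, ℂ)) : Space d → ℂ) ξ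
        = 𝓕⁻ ((𝓕 ψ : 𝓢(Space d, ℂ)) : Space d → ℂ) (-ξ) := by
      rw [Real.fourierInv_eq_fourier_neg, neg_neg]
    rw [this, ← SchwartzMap.fourierInv_coe, FourierTransform.fourierInv_fourier_eq]
  simp_rw [e]
  exact integral_neg_eq_self (fun ξ => ψ ξ * g ξ) volume

lemma exists_schwartz_eq_ofReal {u : Space d → ℝ} (hu : ContDiff ℝ (⊤ : ℕ∞) u)
    (hu' : HasCompactSupport u) : ∃ ψ : 𝓢(Space d, ℂ), ∀ x, ψ x = u x := by
  have hs : HasCompactSupport fun x => (u x : ℂ) :=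
    hu'.comp_left (g := Complex.ofReal) Complex.ofReal_zero
  exact ⟨hs.toSchwartzMap (Complex.ofRealCLM.contDiff.comp hu), fun x => rfl⟩

lemma exists_schwartz_eq_one (R : ℝ) : ∃ ψ : 𝓢(Space d, ℂ), ∀ x, ‖x‖ ≤ R → ψ x = 1 := by
  let B : ContDiffBump (0 : Space d) := ⟨|R| + 1, |R| + 2, by positivity, by linarith⟩
  obtain ⟨ψ, hψ⟩ := exists_schwartz_eq_ofReal B.contDiff B.hasCompactSupport
  refine ⟨ψ, fun x hx => ?_⟩
  have : B x = 1 := B.one_of_mem_closedBall (by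
    rw [mem_closedBall_zero_iff]; linarith [le_abs_self R])
  rw [hψ, this, Complex.ofReal_one]

lemma IsFunction.integrableOn {T : 𝓢'(Space d, ℂ)} {g : Space d → ℂ} (h : IsFunction T g)
    (R : ℝ) : IntegrableOn g (Metric.closedBall 0 R) := by
  obtain ⟨ψ, hψ⟩ := exists_schwartz_eq_one (d := d) R
  refine ((h ψ).1.integrableOn).congr_fun (fun x hx => ?_) measurableSet_closedBall
  simp [hψ x (by simpa using hx)]

lemma IsFunction.locallyIntegrable {T : 𝓢'(Space d, ℂ)} {g : Space d → ℂ}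
    (h : IsFunction T g) : LocallyIntegrable g := by
  rw [locallyIntegrable_iff]
  intro K hK
  obtain ⟨R, hR⟩ := hK.isBounded.subset_closedBall 0
  exact (h.integrableOn R).mono_set hR

lemma IsFunction.integrable {T : 𝓢'(Space d, ℂ)} {g : Space d → ℂ} (h : IsFunction T g) {R : ℝ}
    (hR : ∀ᵐ ξ, R < ‖ξ‖ → g ξ = 0) : Integrable g := by
  rw [← integrableOn_univ]
  refine (h.integrableOn R).of_ae_sdiff_eq_zero nullMeasurableSet_univ ?_
  filter_upwards [hR] with ξ h1 h2
  exact h1 (by simpa using h2.2)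

lemma ae_eq_of_forall_integral_schwartz_eq {g h : Space d → ℂ} (hg : LocallyIntegrable g)
    (hh : LocallyIntegrable h) (H : ∀ ψ : 𝓢(Space d, ℂ), ∫ x, ψ x * g x = ∫ x, ψ x * h x) :
    g =ᵐ[volume] h := by
  refine ae_eq_of_integral_contDiff_smul_eq hg hh fun u hu hu' => ?_
  obtain ⟨ψ, hψ⟩ := exists_schwartz_eq_ofReal hu hu'
  simpa only [Complex.real_smul, hψ] using H ψ

lemma continuous_invFourier {g : Space d → ℂ} (hg : Integrable g) : Continuous (invFourier g) := by
  refine continuous_of_dominated (bound := fun ξ => ‖g ξ‖)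
    (fun x => (integrable_mul_exp hg x).aestronglyMeasurable)
    (fun x => Eventually.of_forall fun ξ => ?_) hg.norm
    (Eventually.of_forall fun ξ => by fun_prop)
  rw [norm_mul, norm_exp_two_pi_I, mul_one]

/-- Testing against Schwartz functions gives equality almost everywhere; continuity of both sides
makes it pointwise, which sampling needs. -/
lemma HasFourierTransform.eq_invFourier {f g : Space d → ℂ} (h : HasFourierTransform f g)
    (hf : Continuous f) (hg : Integrable g) : f = invFourier g := by
  obtain ⟨T, hT, hT'⟩ := h
  refine (hf.ae_eq_iff_eq volume (continuous_invFourier hg)).1 ?_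
  refine ae_eq_of_forall_integral_schwartz_eq hf.locallyIntegrable
    (continuous_invFourier hg).locallyIntegrable fun ψ => ?_
  have h1 := integral_fourier_mul_invFourier hg (𝓕⁻ ψ)
  rw [FourierTransform.fourier_fourierInv_eq] at h1
  rw [h1, ← (hT' _).2, TemperedDistribution.fourier_apply,
    FourierTransform.fourier_fourierInv_eq, (hT ψ).2]

lemma HasFourierTransform.ae_eq_of_invFourier {θ φhat : Space d → ℂ} (hθ : Integrable θ)
    (h : HasFourierTransform (invFourier θ) φhat) : φhat =ᵐ[volume] θ := by
  obtain ⟨T, hT, hT'⟩ := h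
  refine ae_eq_of_forall_integral_schwartz_eq hT'.locallyIntegrable hθ.locallyIntegrable
    fun ψ => ?_
  rw [← integral_fourier_mul_invFourier hθ, ← (hT _).2, ← (hT' _).2,
    TemperedDistribution.fourier_apply]

/-! ### The symbol of the operator and the Fourier transform of its distribution. -/

lemma IsFunction.ae_eq {T : 𝓢'(Space d, ℂ)} {g h : Space d → ℂ} (hg : IsFunction T g)
    (hh : IsFunction T h) : g =ᵐ[volume] h :=
  ae_eq_of_forall_integral_schwartz_eq hg.locallyIntegrable hh.locallyIntegrable
    fun ψ => by rw [← (hg ψ).2, ← (hh ψ).2]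

lemma IsFunction.smul {T : 𝓢'(Space d, ℂ)} {g : Space d → ℂ} (hg : IsFunction T g) (c : ℂ) :
    IsFunction (c • T) fun ξ => c * g ξ := by
  intro ψ
  have e : (fun ξ => ψ ξ * (c * g ξ)) = fun ξ => c * (ψ ξ * g ξ) := by ext ξ; ring
  rw [e, integral_const_mul, ← (hg ψ).2]
  exact ⟨(hg ψ).1.const_mul c, rfl⟩

lemma IsFunction.sum {ι : Type*} (s : Finset ι) {T : ι → 𝓢'(Space d, ℂ)}
    {g : ι → Space d → ℂ} (hg : ∀ i ∈ s, IsFunction (T i) (g i)) :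
    IsFunction (∑ i ∈ s, T i) fun ξ => ∑ i ∈ s, g i ξ := by
  intro ψ
  simp_rw [Finset.mul_sum]
  rw [integral_finsetSum _ fun i hi => (hg i hi ψ).1]
  refine ⟨integrable_finsetSum _ fun i hi => (hg i hi ψ).1, ?_⟩
  rw [sum_apply]
  exact Finset.sum_congr rfl fun i hi => (hg i hi ψ).2

lemma IsFunction.fourier_lineDeriv {T : 𝓢'(Space d, ℂ)} {g : Space d → ℂ}
    (hg : IsFunction (𝓕 T) g) (m : Space d) :
    IsFunction (𝓕 (∂_{m} T)) fun ξ => 2 * Real.pi * Complex.I * (inner ℝ ξ m : ℝ) * g ξ := by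
  rw [TemperedDistribution.fourier_lineDerivOp_eq]
  have hm : (fun ξ : Space d => ((inner ℝ ξ m : ℝ) : ℂ)).HasTemperateGrowth := by fun_prop
  have : IsFunction (TemperedDistribution.smulLeftCLM ℂ
      (fun ξ : Space d => ((inner ℝ ξ m : ℝ) : ℂ)) (𝓕 T)) fun ξ => (inner ℝ ξ m : ℝ) * g ξ := by
    intro ψ
    have h := hg (SchwartzMap.smulLeftCLM ℂ (fun ξ : Space d => ((inner ℝ ξ m : ℝ) : ℂ)) ψ)
    have e : ∀ ξ, SchwartzMap.smulLeftCLM ℂ (fun ξ : Space d => ((inner ℝ ξ m : ℝ) : ℂ)) ψ ξ * g ξ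
        = ψ ξ * ((inner ℝ ξ m : ℝ) * g ξ) := by
      intro ξ
      rw [SchwartzMap.smulLeftCLM_apply_apply hm, smul_eq_mul]
      ring
    simp_rw [e] at h
    exact h
  have h2 := this.smul (2 * Real.pi * Complex.I)
  simpa only [mul_assoc] using h2

/-- The symbol `(2πiξ)^β` of the derivative `D^β`. -/
def monomialSymbol (β : Fin d → ℕ) (ξ : Space d) : ℂ :=
  ∏ i, (2 * Real.pi * Complex.I * (ξ i : ℝ)) ^ β i

lemma foldr_mul_symbol (β : Fin d → ℕ) (ξ : Space d) :
    (List.finRange d).foldr (fun i z => (2 * Real.pi * Complex.I * (ξ i : ℝ)) ^ β i * z) 1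
      = monomialSymbol β ξ := by
  rw [monomialSymbol, ← List.prod_ofFn, List.ofFn_eq_map, List.prod, List.foldr_map]

lemma isFunction_fourier_delta :
    IsFunction (𝓕 (TemperedDistribution.delta (0 : Space d))) fun _ => 1 := by
  intro ψ
  rw [TemperedDistribution.fourier_delta_zero]
  simpa using ψ.integrable

lemma isFunction_fourier_distDeriv_delta (β : Fin d → ℕ) :
    IsFunction (𝓕 (distDeriv β (TemperedDistribution.delta (0 : Space d))))
      (monomialSymbol β) := by
  have hit : ∀ (i : Fin d) (n : ℕ) (S : 𝓢'(Space d, ℂ)) (g : Space d → ℂ), IsFunction (𝓕 S) g →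
      IsFunction (𝓕 ((fun S : 𝓢'(Space d, ℂ) =>
        ∂_{(EuclideanSpace.single i (1 : ℝ) : Space d)} S)^[n] S))
        fun ξ => (2 * Real.pi * Complex.I * (ξ i : ℝ)) ^ n * g ξ := by
    intro i n
    induction n with
    | zero => intro S g h; simpa using h
    | succ n ih =>
      intro S g h
      rw [Function.iterate_succ_apply']
      have := (ih S g h).fourier_lineDeriv (EuclideanSpace.single i (1 : ℝ))
      convert! this using 2 with ξ
      simp [EuclideanSpace.inner_single_right]
      ring
  have hl : ∀ l : List (Fin d), IsFunction (𝓕 (l.foldr (fun i g =>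
      (fun S : 𝓢'(Space d, ℂ) => ∂_{(EuclideanSpace.single i (1 : ℝ) : Space d)} S)^[β i] g)
        (TemperedDistribution.delta (0 : Space d))))
      fun ξ => l.foldr (fun i z => (2 * Real.pi * Complex.I * (ξ i : ℝ)) ^ β i * z) 1 := by
    intro l
    induction l with
    | nil => exact isFunction_fourier_delta
    | cons i l ih => exact hit i (β i) _ _ ih
  have := hl (List.finRange d)
  simp_rw [foldr_mul_symbol] at this
  exact this

/-- The symbol `∑ a_β (2πiξ)^β` of the operator `diffOp N a`. -/
def opSymbol (N : ℕ) (a : (Fin d → ℕ) → ℂ) (ξ : Space d) : ℂ :=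
  ∑ β ∈ multiIndices d N, a β * monomialSymbol β ξ

/-- Each factor `2πiξ_i` is purely imaginary. Hence the signs and conjugate coefficients in
`assocDist` produce exactly the conjugate of `opSymbol`. -/
lemma conj_monomialSymbol (β : Fin d → ℕ) (ξ : Space d) :
    (starRingEnd ℂ) (monomialSymbol β ξ) = (-1) ^ (∑ i, β i) * monomialSymbol β ξ := by
  rw [monomialSymbol, map_prod, ← Finset.prod_pow_eq_pow_sum, ← Finset.prod_mul_distrib]
  refine Finset.prod_congr rfl fun i _ => ?_
  rw [map_pow, ← mul_pow]
  congr 1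
  simp [map_ofNat (starRingEnd ℂ) 2]

lemma isFunction_fourier_assocDist (N : ℕ) (a : (Fin d → ℕ) → ℂ) :
    IsFunction (𝓕 (assocDist N a)) fun ξ => (starRingEnd ℂ) (opSymbol N a ξ) := by
  have h := IsFunction.sum (multiIndices d N) fun β _ =>
    (isFunction_fourier_distDeriv_delta β).smul
      ((starRingEnd ℂ) (a β) * (-1) ^ (∑ i, β i))
  convert! h using 1
  · simp [assocDist]
  · ext ξ
    rw [opSymbol, map_sum]
    refine Finset.sum_congr rfl fun β _ => ?_
    rw [map_mul, conj_monomialSymbol]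
    ring

lemma continuous_monomialSymbol (β : Fin d → ℕ) : Continuous (monomialSymbol (d := d) β) := by
  unfold monomialSymbol; fun_prop

lemma continuous_opSymbol (N : ℕ) (a : (Fin d → ℕ) → ℂ) : Continuous (opSymbol N a) := by
  unfold opSymbol
  exact continuous_finsetSum _ fun β _ => continuous_const.mul (continuous_monomialSymbol β)

/-! ### Differentiation under the inverse Fourier integral. -/

/-- Integrable functions with bounded essential support. -/
def IntegrableBdd (g : Space d → ℂ) : Prop :=
  Integrable g ∧ ∃ R : ℝ, ∀ᵐ ξ, R < ‖ξ‖ → g ξ = 0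

lemma IntegrableBdd.mul_continuous {g c : Space d → ℂ} (hg : IntegrableBdd g)
    (hc : Continuous c) : IntegrableBdd fun ξ => c ξ * g ξ := by
  obtain ⟨hi, R, hR⟩ := hg
  refine ⟨?_, R, hR.mono fun ξ h h' => by simp [h h']⟩
  obtain ⟨C, hC⟩ := (isCompact_closedBall (0 : Space d) R).exists_bound_of_continuousOn
    hc.continuousOn
  refine (hi.norm.const_mul C).mono' (hc.aestronglyMeasurable.mul hi.1) ?_
  filter_upwards [hR] with ξ h
  by_cases hξ : ‖ξ‖ ≤ R
  · rw [norm_mul]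
    exact mul_le_mul_of_nonneg_right (hC ξ (by simpa using hξ)) (norm_nonneg _)
  · simp [h (not_le.1 hξ)]

lemma IntegrableBdd.norm_pow_mul {g : Space d → ℂ} (hg : IntegrableBdd g) (n : ℕ) :
    Integrable fun ξ => ‖ξ‖ ^ n * ‖g ξ‖ := by
  have := (hg.mul_continuous (c := fun ξ => ((‖ξ‖ ^ n : ℝ) : ℂ)) (by fun_prop)).1.norm
  simpa using this

/-- The general transform carries the kernel `e(-L(ξ, x))`, so the inverse transform corresponds to
minus the inner product. This gives access to its smoothness theorems. -/
lemma invFourier_eq_fourierIntegral (g : Space d → ℂ) :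
    invFourier g = VectorFourier.fourierIntegral Real.fourierChar volume
      (-(innerSL ℝ : Space d →L[ℝ] Space d →L[ℝ] ℝ)).toLinearMap₁₂ g := by
  ext x
  rw [invFourier_eq, Real.fourierInv_eq, VectorFourier.fourierIntegral]
  simp

lemma contDiff_invFourier {g : Space d → ℂ} (hg : IntegrableBdd g) (N : ℕ) :
    ContDiff ℝ N (invFourier g) := by
  rw [invFourier_eq_fourierIntegral]
  exact VectorFourier.contDiff_fourierIntegral (N := (N : ℕ∞)) _ fun n _ => hg.norm_pow_mul n

lemma lineDeriv_invFourier {g : Space d → ℂ} (hg : IntegrableBdd g) (x m : Space d) :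
    lineDeriv ℝ (invFourier g) x m
      = invFourier (fun ξ => 2 * Real.pi * Complex.I * (inner ℝ ξ m : ℝ) * g ξ) x := by
  have h1 : Integrable fun ξ => ‖ξ‖ * ‖g ξ‖ := by simpa using hg.norm_pow_mul 1
  rw [invFourier_eq_fourierIntegral, invFourier_eq_fourierIntegral]
  have h := VectorFourier.hasFDerivAt_fourierIntegral
    (-(innerSL ℝ : Space d →L[ℝ] Space d →L[ℝ] ℝ)) hg.1 h1 x
  rw [(h.hasLineDerivAt m).lineDeriv, Real.fourierIntegral_continuousLinearMap_apply']
  · congr 1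
    ext ξ
    change -(2 * Real.pi * Complex.I) • (-(inner ℝ ξ m : ℝ)) • g ξ = _
    rw [Complex.real_smul, smul_eq_mul]
    push_cast
    ring
  · have h2 : AEStronglyMeasurable (VectorFourier.fourierSMulRight
        (-(innerSL ℝ : Space d →L[ℝ] Space d →L[ℝ] ℝ)) g) volume := hg.1.1.fourierSMulRight
    refine (h1.const_mul (2 * Real.pi *
      ‖(-(innerSL ℝ : Space d →L[ℝ] Space d →L[ℝ] ℝ))‖)).mono' h2 ?_
    exact Eventually.of_forall fun ξ => (VectorFourier.norm_fourierSMulRight_le _ _ _).trans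
      (le_of_eq (by ring))

lemma funDeriv_invFourier {g : Space d → ℂ} (hg : IntegrableBdd g) (β : Fin d → ℕ) :
    funDeriv β (invFourier g) = invFourier fun ξ => monomialSymbol β ξ * g ξ := by
  have hit : ∀ (i : Fin d) (n : ℕ) (c : Space d → ℂ), Continuous c →
      (fun (h : Space d → ℂ) x => lineDeriv ℝ h x (EuclideanSpace.single i (1 : ℝ)))^[n]
        (invFourier fun ξ => c ξ * g ξ)
        = invFourier fun ξ => ((2 * Real.pi * Complex.I * (ξ i : ℝ)) ^ n * c ξ) * g ξ := by
    intro i n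
    induction n with
    | zero => intro c _; simp
    | succ n ih =>
      intro c hc
      rw [Function.iterate_succ_apply', ih c hc]
      ext x
      rw [lineDeriv_invFourier (hg.mul_continuous (by fun_prop))]
      congr 1
      ext ξ
      simp [EuclideanSpace.inner_single_right]
      ring
  -- Continuity of the accumulated symbol is carried along, since it keeps the product with `g`
  -- integrable for the next derivative.
  have hl : ∀ l : List (Fin d), l.foldr (fun i h =>
      (fun (h : Space d → ℂ) x => lineDeriv ℝ h x (EuclideanSpace.single i (1 : ℝ)))^[β i] h)
        (invFourier g)
      = (invFourier fun ξ =>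
        (l.foldr (fun i z => (2 * Real.pi * Complex.I * (ξ i : ℝ)) ^ β i * z) 1) * g ξ) ∧
      Continuous fun ξ : Space d =>
        l.foldr (fun i z => (2 * Real.pi * Complex.I * (ξ i : ℝ)) ^ β i * z) (1 : ℂ) := by
    intro l
    induction l with
    | nil => simpa using continuous_const
    | cons i l ih =>
      refine ⟨?_, ?_⟩
      · rw [List.foldr_cons, ih.1, hit i (β i) _ ih.2]
        rfl
      · simp only [List.foldr_cons]
        exact Continuous.mul (by fun_prop) ih.2
  have := (hl (List.finRange d)).1
  simp_rw [foldr_mul_symbol] at this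
  exact this

lemma diffOp_invFourier {g : Space d → ℂ} (hg : IntegrableBdd g) (N : ℕ)
    (a : (Fin d → ℕ) → ℂ) :
    diffOp N a (invFourier g) = invFourier fun ξ => opSymbol N a ξ * g ξ := by
  ext x
  have hi : ∀ β, Integrable fun ξ => monomialSymbol β ξ * g ξ *
      Complex.exp (2 * Real.pi * Complex.I * (inner ℝ x ξ : ℝ)) := fun β =>
    integrable_mul_exp (hg.mul_continuous (continuous_monomialSymbol β)).1 x
  simp only [diffOp, funDeriv_invFourier hg]
  simp only [invFourier, ← integral_const_mul]
  rw [← integral_finsetSum _ fun β _ => (hi β).const_mul _]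
  congr 1
  ext ξ
  rw [opSymbol, Finset.sum_mul, Finset.sum_mul]
  refine Finset.sum_congr rfl fun β _ => by ring

/-! ### Cubic partial sums as box integrals, and the undilated expansion. -/

/-- The parallelepiped `[a, b]` in `ℝ^d`. -/
def spaceBox (a b : Fin d → ℝ) : Set (Space d) := {ξ | ∀ i, ξ i ∈ Set.Icc (a i) (b i)}

lemma toLp_mem_spaceBox {a b ξ : Fin d → ℝ} :
    WithLp.toLp 2 ξ ∈ spaceBox a b ↔ ξ ∈ Set.Icc a b := by
  simp only [spaceBox, Set.mem_ofPred_eq, Set.mem_Icc, Pi.le_def, forall_and]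

lemma measurableEmbedding_toLp :
    MeasurableEmbedding (WithLp.toLp 2 : (Fin d → ℝ) → Space d) :=
  (MeasurableEquiv.toLp 2 (Fin d → ℝ)).measurableEmbedding

lemma integral_eq_setIntegral_Icc {a b : Fin d → ℝ} {h : Space d → ℂ}
    (h0 : ∀ ξ, ξ ∉ spaceBox a b → h ξ = 0) :
    ∫ ξ, h ξ = ∫ ξ in Set.Icc a b, h (WithLp.toLp 2 ξ) := by
  rw [← (PiLp.volume_preserving_toLp (Fin d)).integral_comp measurableEmbedding_toLp,
    setIntegral_eq_integral_of_forall_compl_eq_zero]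
  exact fun ξ hξ => h0 _ fun h' => hξ (toLp_mem_spaceBox.1 h')

lemma integrable_of_continuousOn_spaceBox {a b : Fin d → ℝ} {h : Space d → ℂ}
    (h0 : ∀ ξ, ξ ∉ spaceBox a b → h ξ = 0) (hc : ContinuousOn h (spaceBox a b)) :
    Integrable h := by
  rw [← (PiLp.volume_preserving_toLp (Fin d)).integrable_comp_emb measurableEmbedding_toLp]
  have h1 : ContinuousOn (h ∘ WithLp.toLp 2) (Set.Icc a b) :=
    hc.comp (PiLp.continuous_toLp 2 _).continuousOn fun ξ hξ => toLp_mem_spaceBox.2 hξ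
  refine (integrableOn_iff_integrable_of_support_subset fun ξ hξ => ?_).1
    (h1.integrableOn_compact isCompact_Icc)
  by_contra h'
  exact hξ (h0 _ fun h'' => h' (toLp_mem_spaceBox.1 h''))

/-- The cube `{k : ‖k‖_∞ ≤ n}` in `ℤ^d`. -/
abbrev intCube (d n : ℕ) : Finset (Fin d → ℤ) :=
  Fintype.piFinset fun _ : Fin d => Finset.Icc (-(n : ℤ)) (n : ℤ)

lemma sum_intCube_exp (n : ℕ) (t : Fin d → ℝ) :
    ∑ k ∈ intCube d n, Complex.exp (2 * Real.pi * Complex.I * ((∑ i, k i * t i : ℝ) : ℂ))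
      = ((∏ i, dirichletKernel n (t i) : ℝ) : ℂ) := by
  rw [Complex.ofReal_prod]
  simp_rw [← sum_exp_eq_dirichletKernel]
  rw [Finset.prod_univ_sum]
  refine Finset.sum_congr rfl fun k _ => ?_
  rw [← Complex.exp_sum, Complex.ofReal_sum, Finset.mul_sum]

lemma inner_intPt (k : Fin d → ℤ) (ξ : Space d) :
    (inner ℝ (intPt k) ξ : ℝ) = ∑ i, k i * ξ i := by
  simp [PiLp.inner_apply, intPt, mul_comm]

/-- Summing exponentials over a cube of frequencies factors into one-dimensional Dirichlet kernels;
this is where the cubic shape of the partial sums matters. -/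
lemma boxSum_eq_sum_invFourier {a b : Fin d → ℝ} {θ : Space d → ℂ}
    (h0 : ∀ ξ, ξ ∉ spaceBox a b → θ ξ = 0) (hc : ContinuousOn θ (spaceBox a b))
    (y η : Space d) (n : ℕ) :
    boxSum a b η.ofLp (fun ξ => θ (WithLp.toLp 2 ξ) *
      Complex.exp (2 * Real.pi * Complex.I * (inner ℝ y (WithLp.toLp 2 ξ) : ℝ))) n
      = ∑ k ∈ intCube d n, Complex.exp (2 * Real.pi * Complex.I * (inner ℝ (-intPt k) η : ℝ)) *
        invFourier θ (y + intPt k) := by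
  have hc' : ContinuousOn (fun ξ => θ (WithLp.toLp 2 ξ)) (Set.Icc a b) :=
    hc.comp (PiLp.continuous_toLp 2 _).continuousOn fun ξ hξ => toLp_mem_spaceBox.2 hξ
  have hcont : ∀ x : Space d, Continuous fun ξ : Fin d → ℝ =>
      Complex.exp (2 * Real.pi * Complex.I * (inner ℝ x (WithLp.toLp 2 ξ : Space d) : ℝ)) := by
    intro x
    have := PiLp.continuous_toLp 2 (fun _ : Fin d => ℝ)
    fun_prop
  have e : ∀ k : Fin d → ℤ, invFourier θ (y + intPt k) = ∫ ξ in Set.Icc a b,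
      θ (WithLp.toLp 2 ξ) * Complex.exp (2 * Real.pi * Complex.I *
        (inner ℝ (y + intPt k) (WithLp.toLp 2 ξ) : ℝ)) := fun k =>
    integral_eq_setIntegral_Icc fun ξ hξ => by rw [h0 ξ hξ, zero_mul]
  simp_rw [e, ← integral_const_mul]
  rw [← integral_finsetSum, boxSum]
  · refine integral_congr_ae (Eventually.of_forall fun ξ => ?_)
    dsimp only
    rw [← sum_intCube_exp, Finset.mul_sum]
    refine Finset.sum_congr rfl fun k _ => ?_
    rw [mul_assoc, ← Complex.exp_add, mul_left_comm, ← Complex.exp_add]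
    congr 2
    rw [← mul_add, ← mul_add, ← Complex.ofReal_add, ← Complex.ofReal_add, inner_neg_left,
      inner_add_left, inner_intPt, inner_intPt]
    congr 2
    simp_rw [mul_sub]
    rw [Finset.sum_sub_distrib]
    ring
  · intro k _
    exact ((hc'.mul (hcont _).continuousOn).integrableOn_compact isCompact_Icc).const_mul _

lemma ae_coord_ne (i : Fin d) (c : ℝ) : ∀ᵐ η : Space d, η i ≠ c :=
  (PiLp.volume_preserving_ofLp (Fin d)).quasiMeasurePreserving.ae
    (Measure.ae_eval_ne (fun _ : Fin d => (volume : Measure ℝ)) i c)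

lemma add_intPt_eq (η : Space d) (l : Fin d → ℤ) :
    WithLp.toLp 2 (fun i => η i + (l i : ℝ)) = η + intPt l := rfl

/-- A finite set of integers which contains all `l` with `η i + l ∈ [a i, b i]` for some `i`. -/
lemma exists_finset_int_translates (a b η : Fin d → ℝ) :
    ∃ L : Finset ℤ, 0 ∈ L ∧ ∀ i, ∀ l : ℤ, η i + l ∈ Set.Icc (a i) (b i) → l ∈ L := by
  -- `0` is inserted by hand so that the zero translate, the only one to survive in the limit, is
  -- always an index.
  refine ⟨insert 0 (Finset.univ.biUnion fun i => Finset.Icc ⌈a i - η i⌉ ⌊b i - η i⌋),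
    Finset.mem_insert_self _ _, fun i l hl => Finset.mem_insert_of_mem ?_⟩
  rw [Finset.mem_biUnion]
  refine ⟨i, Finset.mem_univ i, Finset.mem_Icc.2 ⟨Int.ceil_le.2 ?_, Int.le_floor.2 ?_⟩⟩
  · linarith [hl.1]
  · linarith [hl.2]

lemma contDiffOn_mul_exp {a b : Fin d → ℝ} {θ : Space d → ℂ}
    (hθ : ContDiffOn ℝ d θ (spaceBox a b)) (y : Space d) :
    ContDiffOn ℝ d (fun p : ℝ × (Fin d → ℝ) => θ (WithLp.toLp 2 p.2) *
      Complex.exp (2 * Real.pi * Complex.I * (inner ℝ y (WithLp.toLp 2 p.2 : Space d) : ℝ)))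
      (Set.Icc 0 1 ×ˢ Set.Icc a b) := by
  have hL : ContDiff ℝ d fun p : ℝ × (Fin d → ℝ) => (WithLp.toLp 2 p.2 : Space d) :=
    (PiLp.contDiff_toLp).comp contDiff_snd
  refine (hθ.comp hL.contDiffOn fun p hp => toLp_mem_spaceBox.2 hp.2).mul (ContDiff.contDiffOn ?_)
  refine ContDiff.cexp (contDiff_const.mul (Complex.ofRealCLM.contDiff.comp ?_))
  exact contDiff_const.inner ℝ hL

/-- The sampling expansion for a band-limited function, before dilation. -/
theorem tendsto_sum_diffOp_mul {a b : Fin d → ℝ} (hab : ∀ i, a i < b i) {θ : Space d → ℂ}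
    (h0 : ∀ ξ, ξ ∉ spaceBox a b → θ ξ = 0) (hθ : ContDiffOn ℝ d θ (spaceBox a b))
    {G : Space d → ℂ} (hG : IntegrableBdd G) (N : ℕ) (c : (Fin d → ℕ) → ℂ)
    (hsymb : ∀ᵐ ξ, G ξ ≠ 0 → opSymbol N c ξ * θ ξ = 1)
    (htrans : ∀ l : Fin d → ℤ, l ≠ 0 → ∀ᵐ ξ, G ξ ≠ 0 → θ (ξ + intPt l) = 0) (y : Space d) :
    Tendsto (fun n => ∑ k ∈ intCube d n,
      diffOp N c (invFourier G) (-intPt k) * invFourier θ (y + intPt k)) atTop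
      (𝓝 (invFourier G y)) := by
  set H : Space d → ℂ := fun ξ => opSymbol N c ξ * G ξ with hHdef
  have hH : IntegrableBdd H := hG.mul_continuous (continuous_opSymbol N c)
  set S : ℕ → Space d → ℂ := fun n η => ∑ k ∈ intCube d n,
    Complex.exp (2 * Real.pi * Complex.I * (inner ℝ (-intPt k) η : ℝ)) * invFourier θ (y + intPt k)
    with hS
  have hint : ∀ k : Fin d → ℤ, Integrable fun η => H η *
      Complex.exp (2 * Real.pi * Complex.I * (inner ℝ (-intPt k) η : ℝ)) *
        invFourier θ (y + intPt k) := fun k => (integrable_mul_exp hH.1 _).mul_const _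
  have hHS : ∀ n η, H η * S n η = ∑ k ∈ intCube d n, H η *
      Complex.exp (2 * Real.pi * Complex.I * (inner ℝ (-intPt k) η : ℝ)) *
        invFourier θ (y + intPt k) := by
    intro n η
    rw [hS, Finset.mul_sum]
    exact Finset.sum_congr rfl fun k _ => (mul_assoc _ _ _).symm
  have hsum : ∀ n, ∑ k ∈ intCube d n,
      diffOp N c (invFourier G) (-intPt k) * invFourier θ (y + intPt k)
      = ∫ η, H η * S n η := by
    intro n
    simp_rw [hHS]
    rw [integral_finsetSum _ fun k _ => hint k]
    refine Finset.sum_congr rfl fun k _ => ?_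
    rw [diffOp_invFourier hG, integral_mul_const, invFourier]
  -- The parameter in `[0, 1]` is a dummy: the integrand does not depend on it, and it is set to `0`
  -- below.
  obtain ⟨⟨C, hC⟩, hlim⟩ := boxSum_bounded_and_tendsto d ℝ (Set.Icc 0 1) isCompact_Icc
    (uniqueDiffOn_Icc one_pos) a b hab _ (contDiffOn_mul_exp hθ y)
  have h01 : (0 : ℝ) ∈ Set.Icc (0 : ℝ) 1 := ⟨le_rfl, zero_le_one⟩
  have hbox : ∀ n η, S n η = boxSum a b η.ofLp (fun ξ => θ (WithLp.toLp 2 ξ) *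
      Complex.exp (2 * Real.pi * Complex.I * (inner ℝ y (WithLp.toLp 2 ξ) : ℝ))) n :=
    fun n η => (boxSum_eq_sum_invFourier h0 hθ.continuousOn y η n).symm
  simp_rw [hsum]
  refine tendsto_integral_of_dominated_convergence (fun η => C * ‖H η‖) (fun n => ?_)
    (hH.1.norm.const_mul C) (fun n => Eventually.of_forall fun η => ?_) ?_
  · simp_rw [hHS]
    exact (integrable_finsetSum _ fun k _ => hint k).aestronglyMeasurable
  · rw [norm_mul, mul_comm]
    refine mul_le_mul_of_nonneg_right ?_ (norm_nonneg _)
    rw [hbox]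
    exact hC 0 h01 n η.ofLp
  -- Convergence is known only off the integer translates of the hyperplanes bounding the box, which
  -- are null.
  · have hA : ∀ᵐ η : Space d, ∀ i, ∀ l : ℤ, η i ≠ a i - l ∧ η i ≠ b i - l := by
      simp only [ae_all_iff]
      exact fun i l => (ae_coord_ne i _).and (ae_coord_ne i _)
    have hT : ∀ᵐ ξ, ∀ l : Fin d → ℤ, l ≠ 0 → G ξ ≠ 0 → θ (ξ + intPt l) = 0 := by
      rw [ae_all_iff]
      intro l
      by_cases hl : l = 0
      · simp [hl]
      · filter_upwards [htrans l hl] with ξ h _ using h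
    filter_upwards [hA, hT, hsymb] with η h1 h2 h3
    by_cases hGη : G η = 0
    · simp [hHdef, hGη]
    obtain ⟨L, hL0, hL⟩ := exists_finset_int_translates a b η.ofLp
    have hl := hlim 0 h01 η.ofLp
      (fun i l => ⟨fun h => (h1 i l).1 (by linarith), fun h => (h1 i l).2 (by linarith)⟩) L hL
    have hval : ∀ l : Fin d → ℤ, (Set.Icc a b).indicator (fun ξ => θ (WithLp.toLp 2 ξ) *
        Complex.exp (2 * Real.pi * Complex.I * (inner ℝ y (WithLp.toLp 2 ξ) : ℝ)))
        (fun i => η i + (l i : ℝ)) = θ (η + intPt l) *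
        Complex.exp (2 * Real.pi * Complex.I * (inner ℝ y (η + intPt l) : ℝ)) := by
      intro l
      rw [← add_intPt_eq]
      by_cases hm : (fun i => η i + (l i : ℝ)) ∈ Set.Icc a b
      · rw [Set.indicator_of_mem hm]
      · rw [Set.indicator_of_notMem hm, h0 _ fun h => hm (toLp_mem_spaceBox.1 h), zero_mul]
    have hintz : intPt (0 : Fin d → ℤ) = 0 := by ext i; simp [intPt]
    rw [Finset.sum_eq_single (fun _ => ⟨0, hL0⟩)] at hl
    · rw [hval fun _ => 0] at hl
      have hz : intPt (fun _ : Fin d => (0 : ℤ)) = 0 := hintz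
      rw [hz, add_zero] at hl
      have hl2 := hl.const_mul (H η)
      have e : H η * (θ η * Complex.exp (2 * Real.pi * Complex.I * (inner ℝ y η : ℝ)))
          = G η * Complex.exp (2 * Real.pi * Complex.I * (inner ℝ y η : ℝ)) := by
        rw [hHdef]
        linear_combination (G η * Complex.exp (2 * Real.pi * Complex.I * (inner ℝ y η : ℝ)))
          * h3 hGη
      rw [e] at hl2
      refine hl2.congr fun n => ?_
      rw [hbox]
    · intro l _ hl0
      rw [hval fun i => l i, h2 _ (fun h => hl0 ?_) hGη, zero_mul]
      ext i
      exact congrFun h i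
    · intro h; exact absurd (Finset.mem_univ _) h

/-! ### Dilations and the change of variables. -/

lemma mulPt_mulPt (A B : Matrix (Fin d) (Fin d) ℝ) (x : Space d) :
    mulPt A (mulPt B x) = mulPt (A * B) x := by
  simp [mulPt]

lemma mulPt_one (x : Space d) : mulPt 1 x = x := by
  simp [mulPt]

lemma inner_mulPt_transpose (A : Matrix (Fin d) (Fin d) ℝ) (x y : Space d) :
    (inner ℝ (mulPt A.transpose x) y : ℝ) = inner ℝ x (mulPt A y) := by
  simp only [mulPt, Matrix.toLpLin_apply, EuclideanSpace.inner_eq_star_dotProduct, star_trivial]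
  rw [Matrix.mulVec_transpose, dotProduct_comm, ← Matrix.dotProduct_mulVec, dotProduct_comm]

lemma IsDilation.isUnit_det {M : Matrix (Fin d) (Fin d) ℝ} (hM : IsDilation M) :
    IsUnit M.det := by
  rw [isUnit_iff_ne_zero]
  intro h
  have h1 : (M.map (fun r : ℝ => (r : ℂ))).det = 0 := by
    have := (Complex.ofRealHom).map_det M
    rw [h, map_zero] at this
    exact this.symm
  obtain ⟨v, hv, hv'⟩ := Matrix.exists_mulVec_eq_zero_iff.2 h1
  have h2 : Module.End.HasEigenvector
      (Matrix.toLin' (M.map (fun r : ℝ => (r : ℂ)))) 0 v := by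
    refine ⟨Module.End.mem_eigenspace_iff.2 ?_, hv⟩
    rw [Matrix.toLin'_apply, hv', zero_smul]
  have := hM 0 (Module.End.hasEigenvalue_of_hasEigenvector h2)
  simp at this
  linarith

/-- The linear automorphism of `ℝ^d` given by an invertible matrix. -/
def mulEquiv (A B : Matrix (Fin d) (Fin d) ℝ) (hAB : A * B = 1) (hBA : B * A = 1) :
    Space d ≃ₗ[ℝ] Space d :=
  LinearEquiv.ofLinearMap (Matrix.toEuclideanLin A) (Matrix.toEuclideanLin B)
    (LinearMap.ext fun x => (mulPt_mulPt A B x).trans (by rw [hAB, mulPt_one]; rfl))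
    (LinearMap.ext fun x => (mulPt_mulPt B A x).trans (by rw [hBA, mulPt_one]; rfl))

section Invertible

variable {A B : Matrix (Fin d) (Fin d) ℝ}

lemma mulPt_cancel (hAB : A * B = 1) (x : Space d) : mulPt A (mulPt B x) = x := by
  rw [mulPt_mulPt, hAB, mulPt_one]

lemma exists_map_mulPt (hAB : A * B = 1) (hBA : B * A = 1) :
    ∃ c : ℝ, Measure.map (mulPt A) (volume : Measure (Space d)) = ENNReal.ofReal c • volume ∧
      0 ≤ c := by
  refine ⟨|(LinearMap.det (mulEquiv A B hAB hBA : Space d →ₗ[ℝ] Space d))⁻¹|, ?_, abs_nonneg _⟩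
  exact Measure.map_linearMap_addHaar_eq_smul_addHaar _
    (LinearEquiv.isUnit_det' (mulEquiv A B hAB hBA)).ne_zero

lemma measurableEmbedding_mulPt (hAB : A * B = 1) (hBA : B * A = 1) :
    MeasurableEmbedding (mulPt A : Space d → Space d) :=
  (mulEquiv A B hAB hBA).toContinuousLinearEquiv.toHomeomorph.measurableEmbedding

lemma ae_mulPt (hAB : A * B = 1) (hBA : B * A = 1) {P : Space d → Prop} (hP : ∀ᵐ ξ, P ξ) :
    ∀ᵐ η, P (mulPt A η) := by
  obtain ⟨c, hc, -⟩ := exists_map_mulPt hAB hBA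
  rw [← (measurableEmbedding_mulPt hAB hBA).ae_map_iff, hc]
  exact Measure.ae_smul_measure hP _

lemma exists_norm_mulPt_le (A : Matrix (Fin d) (Fin d) ℝ) :
    ∃ C : ℝ, 0 ≤ C ∧ ∀ x : Space d, ‖mulPt A x‖ ≤ C * ‖x‖ :=
  ⟨‖(Matrix.toEuclideanLin A).toContinuousLinearMap‖, norm_nonneg _,
    fun x => (Matrix.toEuclideanLin A).toContinuousLinearMap.le_opNorm x⟩

/-- Substitution `η = Aξ`. The constant is the Jacobian factor of the image of Lebesgue measure
under `A`; its value is never needed. -/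
lemma exists_invFourier_comp_mulPt (hAB : A * B = 1) (hBA : B * A = 1) {g : Space d → ℂ}
    (hg : IntegrableBdd g) :
    ∃ c : ℂ, IntegrableBdd (fun η => c * g (mulPt B η)) ∧
      ∀ y, invFourier g (mulPt A.transpose y) = invFourier (fun η => c * g (mulPt B η)) y := by
  obtain ⟨c, hc, hc0⟩ := exists_map_mulPt hAB hBA
  obtain ⟨c', hc', -⟩ := exists_map_mulPt hBA hAB
  have hemb := measurableEmbedding_mulPt hAB hBA
  refine ⟨c, ⟨?_, ?_⟩, fun y => ?_⟩
  · refine Integrable.const_mul ?_ _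
    refine ((measurableEmbedding_mulPt hBA hAB).integrable_map_iff (g := g)).1 ?_
    rw [hc']
    exact hg.1.smul_measure ENNReal.ofReal_ne_top
  · obtain ⟨-, R, hR⟩ := hg
    obtain ⟨C, hC0, hC⟩ := exists_norm_mulPt_le A
    refine ⟨C * R, (ae_mulPt hBA hAB hR).mono fun η h hη => ?_⟩
    refine mul_eq_zero_of_right _ (h ?_)
    by_contra! hle
    have := hC (mulPt B η)
    rw [mulPt_cancel hAB] at this
    exact absurd (this.trans (mul_le_mul_of_nonneg_left hle hC0)) (not_le.2 hη)
  · have h := hemb.integral_map (μ := volume) (fun η => g (mulPt B η) *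
      Complex.exp (2 * Real.pi * Complex.I * (inner ℝ y η : ℝ)))
    rw [hc, integral_smul_measure, ENNReal.toReal_ofReal hc0] at h
    simp_rw [mulPt_cancel hBA] at h
    simp only [invFourier, inner_mulPt_transpose]
    rw [← h, Complex.real_smul, ← integral_const_mul]
    simp only [mul_assoc]

end Invertible

lemma cubicSum_eq {M : Matrix (Fin d) (Fin d) ℝ} (hM : IsUnit M.det) (N : ℕ)
    (a : (Fin d → ℕ) → ℂ) (φ : Space d → ℂ) (j : ℤ) (f : Space d → ℂ) (x : Space d) (n : ℕ) :
    cubicSum M N a φ j f x n = ∑ k ∈ intCube d n,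
      diffOp N a (fun y => f (mulPt (M ^ (-j)) y)) (-intPt k) *
        φ (mulPt (M ^ j) x + intPt k) := by
  have hm : 0 < |M.det| := abs_pos.2 hM.ne_zero
  have h : ((|M.det| ^ (-(j : ℝ) / 2) : ℝ) : ℂ) * ((|M.det| ^ ((j : ℝ) / 2) : ℝ) : ℂ) = 1 := by
    rw [← Complex.ofReal_mul, ← Real.rpow_add hm]
    have : -(j : ℝ) / 2 + j / 2 = 0 := by ring
    rw [this, Real.rpow_zero, Complex.ofReal_one]
  rw [cubicSum, Finset.mul_sum]
  refine Finset.sum_congr rfl fun k _ => ?_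
  rw [dilShift]
  linear_combination (diffOp N a (fun y => f (mulPt (M ^ (-j)) y)) (-intPt k) *
        φ (mulPt (M ^ j) x + intPt k)) * h

/-- The sampling expansion for a function whose spectrum lies in a dilate of a bounded set on
which the symbols are reciprocal and whose nonzero integer translates `θ` does not charge. -/
theorem sampling_of_fourierSupportedIn {M : Matrix (Fin d) (Fin d) ℝ} (hM : IsUnit M.det)
    (N : ℕ) (c : (Fin d → ℕ) → ℂ) {a b : Fin d → ℝ} (hab : ∀ i, a i < b i) {θ : Space d → ℂ}
    (h0 : ∀ ξ, ξ ∉ spaceBox a b → θ ξ = 0) (hθ : ContDiffOn ℝ d θ (spaceBox a b))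
    {U : Set (Space d)} {R : ℝ} (hUR : ∀ ξ ∈ U, ‖ξ‖ ≤ R)
    (hsymb : ∀ᵐ ξ, ξ ∈ U → opSymbol N c ξ * θ ξ = 1)
    (htrans : ∀ l : Fin d → ℤ, l ≠ 0 → ∀ᵐ ξ, ξ ∈ U → θ (ξ + intPt l) = 0)
    {j : ℤ} {f : Space d → ℂ} (hf : Continuous f) {s : Set (Space d)}
    (hs : FourierSupportedIn f s) (hsU : ∀ η, mulPt (M.transpose ^ j) η ∈ s → η ∈ U) :
    ContDiff ℝ N f ∧
      ∀ x, Tendsto (cubicSum M N c (invFourier θ) j f x) atTop (𝓝 (f x)) := by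
  obtain ⟨g, hfg, hgs⟩ := hs
  have hMt : IsUnit M.transpose.det := by rwa [Matrix.det_transpose]
  have hAB : M.transpose ^ (-j) * M.transpose ^ j = 1 := by
    rw [← Matrix.zpow_add hMt]; simp
  have hBA : M.transpose ^ j * M.transpose ^ (-j) = 1 := by
    rw [← Matrix.zpow_add hMt]; simp
  have hMM : M ^ (-j) * M ^ j = 1 := by rw [← Matrix.zpow_add hM]; simp
  -- The spectrum lies in the image of the bounded set `U` under a linear map, so it is bounded.
  have hgb : ∃ R' : ℝ, ∀ᵐ ξ, R' < ‖ξ‖ → g ξ = 0 := by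
    obtain ⟨C, hC0, hC⟩ := exists_norm_mulPt_le (M.transpose ^ j)
    refine ⟨C * R, hgs.mono fun ξ h hξ => h fun hξs => ?_⟩
    have h1 : mulPt (M.transpose ^ (-j)) ξ ∈ U := hsU _ (by rwa [mulPt_cancel hBA])
    have h2 := hC (mulPt (M.transpose ^ (-j)) ξ)
    rw [mulPt_cancel hBA] at h2
    exact absurd (h2.trans (mul_le_mul_of_nonneg_left (hUR _ h1) hC0)) (not_le.2 hξ)
  have hgi : IntegrableBdd g := by
    obtain ⟨T, -, hT⟩ := id hfg
    obtain ⟨R', hR'⟩ := hgb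
    exact ⟨hT.integrable hR', R', hR'⟩
  have hfeq := hfg.eq_invFourier hf hgi.1
  -- Applied with `A` the power `-j` of the transpose of `M`, so that `A.transpose` is `M ^ (-j)`.
  obtain ⟨r, hG, hGf⟩ := exists_invFourier_comp_mulPt hAB hBA hgi
  refine ⟨hfeq ▸ contDiff_invFourier hgi N, fun x => ?_⟩
  have hF : (fun y => f (mulPt (M ^ (-j)) y))
      = invFourier fun η => r * g (mulPt (M.transpose ^ j) η) := by
    ext y
    rw [← hGf, ← hfeq, ← Matrix.transpose_zpow, Matrix.transpose_transpose]
  have hGU : ∀ᵐ η, r * g (mulPt (M.transpose ^ j) η) ≠ 0 → η ∈ U := by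
    filter_upwards [ae_mulPt hBA hAB hgs] with η h hη
    by_contra hηU
    exact hη (by rw [h fun hs' => hηU (hsU η hs'), mul_zero])
  have key := tendsto_sum_diffOp_mul hab h0 hθ hG N c
    (by filter_upwards [hGU, hsymb] with η h1 h2 h3 using h2 (h1 h3))
    (fun l hl => by filter_upwards [hGU, htrans l hl] with η h1 h2 h3 using h2 (h1 h3))
    (mulPt (M ^ j) x)
  rw [← hF] at key
  simp only [mulPt_cancel hMM] at key
  exact key.congr fun n => (cubicSum_eq hM N c _ j f x n).symm

/-! ### Translates of the spectral sets and the final assembly. -/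

lemma ae_add_intPt {P : Space d → Prop} (hP : ∀ᵐ ξ, P ξ) (l : Fin d → ℤ) :
    ∀ᵐ ξ, P (ξ + intPt l) :=
  (measurePreserving_add_right volume (intPt l)).quasiMeasurePreserving.ae hP

lemma norm_le_of_mem_unitCube {ξ : Space d} (hξ : ξ ∈ unitCube d) : ‖ξ‖ ≤ √(d : ℝ) := by
  rw [EuclideanSpace.norm_eq]
  refine Real.sqrt_le_sqrt ((Finset.sum_le_sum (g := fun _ => (1 : ℝ)) fun i _ => ?_).trans
    (by simp))
  have := abs_le.2 (hξ i)
  rw [Real.norm_eq_abs]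
  nlinarith [abs_nonneg (ξ i)]

/-- Integer translates of the cube overlap only on faces: in a coordinate with `l i ≠ 0`, both
points can lie in the cube only if `ξ i = ±1/2`. -/
lemma ae_add_intPt_notMem_unitCube {l : Fin d → ℤ} (hl : l ≠ 0) :
    ∀ᵐ ξ : Space d, ξ ∈ unitCube d → ξ + intPt l ∉ unitCube d := by
  obtain ⟨i, hi⟩ := Function.ne_iff.1 hl
  filter_upwards [ae_coord_ne i (1 / 2), ae_coord_ne i (-(1 / 2))] with ξ h1 h2 hξ hξ'
  have h3 := hξ i
  have h4 := hξ' i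
  have e : (ξ + intPt l) i = ξ i + l i := rfl
  rw [e] at h4
  have h5 : ξ i < 1 / 2 := lt_of_le_of_ne h3.2 h1
  have h6 : -(1 / 2) < ξ i := lt_of_le_of_ne h3.1 (Ne.symm h2)
  have h7 : (-1 : ℝ) < l i := by linarith [h4.1]
  have h8 : (l i : ℝ) < 1 := by linarith [h4.2]
  norm_cast at h7 h8
  refine hi (?_ : l i = 0)
  omega

end DiffSampling

end

theorem corollary17 {d : ℕ} (hd : 0 < d) (M : Matrix (Fin d) (Fin d) ℝ) (hM : IsDilation M)
    (N : ℕ) (a : (Fin d → ℕ) → ℂ) (ha : a 0 ≠ 0)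
    (φ : Space d → ℂ) (hφ : φ ∈ ClassB d)
    (δ : ℝ) (hδ : StrictlyCompatibleWith δ (assocDist N a) φ) :
    (∀ (j : ℤ) (f : Space d → ℂ), Continuous f →
      FourierSupportedIn f {ξ | ‖mulPt (M.transpose ^ (-j)) ξ‖ < δ} →
      ContDiff ℝ N f ∧
        ∀ x : Space d, Tendsto (cubicSum M N a φ j f x) atTop (𝓝 (f x))) ∧
    ((∃ φhat φthat : Space d → ℂ,
        HasFourierTransform φ φhat ∧ IsFunction (𝓕 (assocDist N a)) φthat ∧
        (∀ᵐ ξ, ξ ∉ unitCube d → φhat ξ = 0) ∧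
        (∀ᵐ ξ, ξ ∈ unitCube d → φhat ξ * (starRingEnd ℂ) (φthat ξ) = 1)) →
      ∀ (j : ℤ) (f : Space d → ℂ), Continuous f →
        FourierSupportedIn f (mulPt (M.transpose ^ j) '' unitCube d) →
        ContDiff ℝ N f ∧
          ∀ x : Space d, Tendsto (cubicSum M N a φ j f x) atTop (𝓝 (f x))) := by
  obtain ⟨p, q, θ, hpq, h0, hθ, hφθ⟩ := hφ
  have hφ' : φ = invFourier θ := funext hφθ
  subst hφ'
  have hθi : Integrable θ := integrable_of_continuousOn_spaceBox h0 hθ.continuousOn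
  have hdet := hM.isUnit_det
  obtain ⟨-, -, φhat, φthat, hφhat, hφthat, hone, hzero⟩ := hδ
  -- Any representatives of the two transforms agree a.e. with `θ` and the conjugate symbol, so both
  -- sets of hypotheses become conditions on `θ` and `opSymbol`.
  have e1 := hφhat.ae_eq_of_invFourier hθi
  have e2 := hφthat.ae_eq (isFunction_fourier_assocDist N a)
  refine ⟨fun j f hf hs => ?_, ?_⟩
  · refine sampling_of_fourierSupportedIn (U := {ξ | ‖ξ‖ < δ}) (R := δ) hdet N a hpq h0 hθ
      (fun ξ hξ => le_of_lt hξ) ?_ (fun l hl => ?_) hf hs fun η hη => ?_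
    · filter_upwards [e1, e2, hone] with ξ h1 h2 h3 hξ
      have := congrArg (starRingEnd ℂ) (h3 hξ)
      rw [h1, h2, map_mul, Complex.conj_conj, Complex.conj_conj, map_one] at this
      rw [mul_comm, this]
    · filter_upwards [ae_add_intPt e1 l, ae_add_intPt (hzero l hl) l] with ξ h1 h2 hξ
      rw [← h1]
      exact h2 (by simpa using hξ)
    · have hMt : IsUnit M.transpose.det := by rwa [Matrix.det_transpose]
      have hAB : M.transpose ^ (-j) * M.transpose ^ j = 1 := by
        rw [← Matrix.zpow_add hMt]; simp
      have h : ‖mulPt (M.transpose ^ (-j)) (mulPt (M.transpose ^ j) η)‖ < δ := hη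
      rwa [mulPt_cancel hAB] at h
  · rintro ⟨φhat', φthat', hφhat', hφthat', hzero', hone'⟩ j f hf hs
    have e1' := hφhat'.ae_eq_of_invFourier hθi
    have e2' := hφthat'.ae_eq (isFunction_fourier_assocDist N a)
    refine sampling_of_fourierSupportedIn (U := unitCube d) hdet N a hpq h0 hθ
      (fun ξ hξ => norm_le_of_mem_unitCube hξ) ?_ (fun l hl => ?_) hf hs fun η hη => ?_
    · filter_upwards [e1', e2', hone'] with ξ h1 h2 h3 hξ
      have := h3 hξ
      rw [h1, h2, Complex.conj_conj] at this
      rw [mul_comm, this]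
    · filter_upwards [ae_add_intPt e1' l, ae_add_intPt hzero' l,
        ae_add_intPt_notMem_unitCube hl] with ξ h1 h2 h3 hξ
      rw [← h1]
      exact h2 (h3 hξ)
    · have hMt : IsUnit M.transpose.det := by rwa [Matrix.det_transpose]
      have hAB : M.transpose ^ (-j) * M.transpose ^ j = 1 := by
        rw [← Matrix.zpow_add hMt]; simp
      obtain ⟨ξ, hξ, hξη⟩ := hη
      rwa [← mulPt_cancel hAB η, ← hξη, mulPt_cancel hAB]
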